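/- Let $\delta\in\mathbb C$, and let $W$ be the complex vector space of all analytic functions $f:(0,\infty)\to\mathbb C$ such that $f$ and all its derivatives tend to $0$ faster than any inverse power of $x$ as $x\to\infty$. On $W$ consider the operators $$A(u)=(u-\tfrac12)x^{-1}+\partial_x+\tfrac12x^{-1}+\frac{\delta}{u-\frac12},\qquad B(u)=x^{-2},$$ $$C(u)=-x^2\partial_x^2-x\partial_x+\tfrac14x^2+2\delta x+u^2,\qquad D(u)=(u+\tfrac32)x^{-1}-\partial_x-\tfrac12x^{-1}+\frac{\delta}{u-\frac12},$$ defined for $u\in S_\delta$, where $S_0=\mathbb C$ (the terms with $\delta$ being absent for $\delta=0$) and $S_\delta=\mathbb C\setminus\{\frac12\}$ if $\delta\ne0$. Let $\Psi(a,c;x)$ be Tricomi's confluent hypergeometric function, i.e. the analytic solution on $(0,\infty)$ of $xf''+(c-x)f'-af=0$ of at most polynomial growth as $x\to\infty$, normalized by $f(x)=x^{-a}+O(|x^{-a-1}|)$ as $x\to\infty$, and put $$F(u)(x)=x^u e^{-x/2}\,\Psi(2\delta+\tfrac12+u,\,2u+1;\,x).$$ Then $F(u)\in W$ for all $u\in\mathbb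 C$. Moreover, in each of the cases (1)--(3) below, with $\mathcal D=\{u_0+m: m\in\mathbb Z,\ j_-<m<j_+\}$, the following holds. (a) The operators preserve $W$ and $U(u)=\begin{pmatrix}A(u)&B(u)\\C(u)&D(u)\end{pmatrix}$, $u\in S_\delta$, gives a representation on $W$ of the QISM II algebra with spectral parameter in $S_\delta$. This is the complex algebra generated by the entries of $U(u)$, $u\in S_\delta$, with relations $$R(u-v)\,U^{(1)}(u)\,R(u+v-1)\,U^{(2)}(v)=U^{(2)}(v)\,R(u+v-1)\,U^{(1)}(u)\,R(u-v),\qquad u,v\in S_\delta,$$ where $R(u)=u+P$, $P$ is the flip on $\mathbb C^2\otimes\mathbb C^2$, $U^{(1)}=U\otimes I$, $U^{(2)}=I\otimes U$, and, whenever $u,-u\in S_\delta$, $$-A(-u)=D(u)-\frac{A(u)+D(u)}{2u+1},\quad -D(-u)=A(u)-\frac{A(u)+D(u)}{2u+1}\quad(u\ne-\tfrac12),\qquad B(-u)=B(u),\quad C(-u)=C(u).$$ (b) $u,-u\in S_\delta$ for every $u\in\mathcal D$, and $\{w\in W: C(u)w=0\}$ is one-dimensional and contains $F(u)\neq0$.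 (c) If $u\in\mathcal D$, $0\ne w\in W$ and $C(u)w=0$, then $A(u)w=0$ if and only if $j_-$ is finite and $u=u_0+j_-+1$; and $-A(-u)w=0$ if and only if $j_+$ is finite and $u=u_0+j_+-1$. The cases are: (1) $\mathcal D=u_0+\mathbb Z$ (that is, $j_\pm=\pm\infty$), if $u_0\notin\pm(2\delta+\frac12)+\mathbb Z$ and $u_0\notin\frac12+\mathbb Z$; (2) $\mathcal D=\{-2\delta-\frac12,\,-2\delta-\frac12-1,\,-2\delta-\frac12-2,\dots\}$ (with $u_0=-2\delta-\frac12$, $j_-=-\infty$, $j_+=1$), if $\delta\ne0$ and $-4\delta-1\ne0,1,2,\dots$; (3) $\mathcal D=\{2\delta+\frac12,\,2\delta+\frac12+1,\dots,-2\delta-\frac12\}$ (with $u_0=2\delta+\frac12$, $j_-=-1$, $j_+=-4\delta$), if $2\delta+\frac12\in\{0,-1,-2,\dots\}$. In cases (2) and (3) every $u\in\mathcal D$ has the form $u=-2\delta-\frac12-n$ with $n\in\{0,1,2,\dots\}$, and $$F(u)(x)=(-1)^n\,n!\;x^{u}e^{-x/2}L_n^{(2u)}(x)=(-1)^n\,n!\;x^{-2\delta-\frac12}e^{-x/2}\,\widetilde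 L_n^{(2u)}(x^{-1}),$$ where $L_n^{(\alpha)}(x)=\sum_{k=0}^n\frac{(\alpha+k+1)_{n-k}}{(n-k)!}\frac{(-x)^k}{k!}$ is the Laguerre polynomial and $\widetilde L_n^{(\alpha)}(y)=y^nL_n^{(\alpha)}(1/y)$ is the polynomial with the reversed list of coefficients. -/

import Mathlib

open scoped Kronecker Topology

noncomputable section

/-! ## The quadratic algebra -/

/-- The rational `4 × 4` matrix `R(u) = u + P`, `P` the flip of `ℂ² ⊗ ℂ²`, with entries in a
complex algebra. -/
def rMatrix (𝒜 : Type*) [Ring 𝒜] [Algebra ℂ 𝒜] (u : ℂ) :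
    Matrix (Fin 2 × Fin 2) (Fin 2 × Fin 2) 𝒜 :=
  u • (1 : Matrix (Fin 2 × Fin 2) (Fin 2 × Fin 2) 𝒜) +
    Matrix.of fun p q => if p.1 = q.2 ∧ p.2 = q.1 then (1 : 𝒜) else 0

/-- `M ⊗ I`. -/
def firstLeg {𝒜 : Type*} [Ring 𝒜] (M : Matrix (Fin 2) (Fin 2) 𝒜) :
    Matrix (Fin 2 × Fin 2) (Fin 2 × Fin 2) 𝒜 :=
  M ⊗ₖ (1 : Matrix (Fin 2) (Fin 2) 𝒜)

/-- `I ⊗ M`. -/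
def secondLeg {𝒜 : Type*} [Ring 𝒜] (M : Matrix (Fin 2) (Fin 2) 𝒜) :
    Matrix (Fin 2 × Fin 2) (Fin 2 × Fin 2) 𝒜 :=
  (1 : Matrix (Fin 2) (Fin 2) 𝒜) ⊗ₖ M

/-- `R(u-v) U⁽¹⁾(u) R(u+v-1) U⁽²⁾(v)`, where `M = U(u)` and `N = U(v)`. -/
def reflectionLeft {𝒜 : Type*} [Ring 𝒜] [Algebra ℂ 𝒜] (u v : ℂ)
    (M N : Matrix (Fin 2) (Fin 2) 𝒜) : Matrix (Fin 2 × Fin 2) (Fin 2 × Fin 2) 𝒜 :=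
  rMatrix 𝒜 (u - v) * firstLeg M * rMatrix 𝒜 (u + v - 1) * secondLeg N

/-- `U⁽²⁾(v) R(u+v-1) U⁽¹⁾(u) R(u-v)`, where `M = U(u)` and `N = U(v)`. -/
def reflectionRight {𝒜 : Type*} [Ring 𝒜] [Algebra ℂ 𝒜] (u v : ℂ)
    (M N : Matrix (Fin 2) (Fin 2) 𝒜) : Matrix (Fin 2 × Fin 2) (Fin 2 × Fin 2) 𝒜 :=
  secondLeg N * rMatrix 𝒜 (u + v - 1) * firstLeg M * rMatrix 𝒜 (u - v)

/-- The free complex algebra on the entries of the matrices `U(u)`, `u ∈ S`. -/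
abbrev FreeQISM (S : Set ℂ) : Type := FreeAlgebra ℂ (S × Fin 2 × Fin 2)

/-- The matrix `U(u) = !![A(u), B(u); C(u), D(u)]` of free generators. -/
def freeU (S : Set ℂ) (u : S) : Matrix (Fin 2) (Fin 2) (FreeQISM S) :=
  Matrix.of fun i j => FreeAlgebra.ι ℂ (u, i, j)

/-- The defining relations of the QISM II algebra: the entries of
`R(u-v) U⁽¹⁾(u) R(u+v-1) U⁽²⁾(v) = U⁽²⁾(v) R(u+v-1) U⁽¹⁾(u) R(u-v)`, and the symmetry relations
under `u ↦ -u`. -/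
inductive QISMRel (S : Set ℂ) : FreeQISM S → FreeQISM S → Prop
  | reflection (u v : S) (p q : Fin 2 × Fin 2) :
      QISMRel S (reflectionLeft (u : ℂ) v (freeU S u) (freeU S v) p q)
        (reflectionRight (u : ℂ) v (freeU S u) (freeU S v) p q)
  | symmA (u v : S) (hv : (v : ℂ) = -u) (hu : 2 * (u : ℂ) + 1 ≠ 0) :
      QISMRel S (-freeU S v 0 0)
        (freeU S u 1 1 - (2 * (u : ℂ) + 1)⁻¹ • (freeU S u 0 0 + freeU S u 1 1))
  | symmD (u v : S) (hv : (v : ℂ) = -u) (hu : 2 * (u : ℂ) + 1 ≠ 0) :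
      QISMRel S (-freeU S v 1 1)
        (freeU S u 0 0 - (2 * (u : ℂ) + 1)⁻¹ • (freeU S u 0 0 + freeU S u 1 1))
  | symmB (u v : S) (hv : (v : ℂ) = -u) : QISMRel S (freeU S v 0 1) (freeU S u 0 1)
  | symmC (u v : S) (hv : (v : ℂ) = -u) : QISMRel S (freeU S v 1 0) (freeU S u 1 0)

/-- The (unitary) QISM II algebra whose spectral parameter ranges over `S ⊆ ℂ`. -/
abbrev QISMAlgebra (S : Set ℂ) : Type := RingQuot (QISMRel S)

/-- The generators of the QISM II algebra; the entries `(0,0)`, `(0,1)`, `(1,0)`, `(1,1)` are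
`A(u)`, `B(u)`, `C(u)`, `D(u)`. -/
def qismGen (S : Set ℂ) (u : S) : Matrix (Fin 2) (Fin 2) (QISMAlgebra S) :=
  (freeU S u).map (RingQuot.mkAlgHom ℂ (QISMRel S))

/-- The operators `U(u)`, `u ∈ S`, give an algebra representation of the QISM II algebra
(spectral parameter in `S`) on `W`. -/
def IsQISMRep (S : Set ℂ) {W : Type*} [AddCommGroup W] [Module ℂ W]
    (U : ℂ → Matrix (Fin 2) (Fin 2) (Module.End ℂ W)) : Prop :=
  ∃ ρ : QISMAlgebra S →ₐ[ℂ] Module.End ℂ W, ∀ (u : S) (i j : Fin 2), ρ (qismGen S u i j) = U u i j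

/-- The set `{u₀ + m | m ∈ ℤ, j₋ < m < j₊}`, where `j₋` is an integer or `-∞` (`⊥`) and
`j₊` is an integer or `+∞` (`⊤`). -/
def ladder (u₀ : ℂ) (jm : WithBot ℤ) (jp : WithTop ℤ) : Set ℂ :=
  {u | ∃ m : ℤ, jm < (m : WithBot ℤ) ∧ (m : WithTop ℤ) < jp ∧ u = u₀ + m}

/-- The hypotheses of the theorem on parameter shifting: a representation of the QISM II algebra
on `W`, a set `𝒟 = ladder u₀ jm jp` of parameters `u` at which the operators `A(u)`, `-A(-u)`,
`C(u)` exist, such that the null space of `C(u)` on `W` is one-dimensional, `A(u)` annihilates it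
exactly at the lower end of `𝒟` and `-A(-u)` annihilates it exactly at the upper end of `𝒟`,
and a choice of nonzero elements `F(u)` of these null spaces. -/
structure MeetsShiftHypotheses (S : Set ℂ) {W : Type*} [AddCommGroup W] [Module ℂ W]
    (U : ℂ → Matrix (Fin 2) (Fin 2) (Module.End ℂ W))
    (u₀ : ℂ) (jm : WithBot ℤ) (jp : WithTop ℤ) (F : ℂ → W) : Prop where
  isRep : IsQISMRep S U
  mem_domain : ∀ u ∈ ladder u₀ jm jp, u ∈ S ∧ -u ∈ S
  one_dim : ∀ u ∈ ladder u₀ jm jp, Module.finrank ℂ (LinearMap.ker (U u 1 0)) = 1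
  lowering : ∀ u ∈ ladder u₀ jm jp, ∀ w : W, w ≠ 0 → U u 1 0 w = 0 →
    (U u 0 0 w = 0 ↔ ∃ j : ℤ, jm = (j : WithBot ℤ) ∧ u = u₀ + j + 1)
  raising : ∀ u ∈ ladder u₀ jm jp, ∀ w : W, w ≠ 0 → U u 1 0 w = 0 →
    ((-U (-u) 0 0) w = 0 ↔ ∃ j : ℤ, jp = (j : WithTop ℤ) ∧ u = u₀ + j - 1)
  ne_zero : ∀ u ∈ ladder u₀ jm jp, F u ≠ 0
  annihilated : ∀ u ∈ ladder u₀ jm jp, U u 1 0 (F u) = 0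

/-! ## The function space -/

/-- Membership in `W`: `f` is a complex-valued analytic function on `(0, ∞)`, and `f` and all its
derivatives tend to `0` at `∞` faster than any inverse power of `x`. A function on `(0, ∞)` is
represented by its extension by zero to `ℝ`. -/
structure IsRapid (f : ℝ → ℂ) : Prop where
  zero : ∀ x ≤ 0, f x = 0
  analytic : AnalyticOnNhd ℝ f (Set.Ioi 0)
  decay : ∀ p N : ℕ,
    Filter.Tendsto (fun x : ℝ => (x : ℂ) ^ N * iteratedDeriv p f x) Filter.atTop (𝓝 0)

theorem IsRapid.contDiffAt {f : ℝ → ℂ} (hf : IsRapid f) (n : ℕ) {x : ℝ} (hx : 0 < x) :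
    ContDiffAt ℝ n f x := (hf.analytic x hx).contDiffAt

theorem isRapid_zero : IsRapid 0 where
  zero := by simp
  analytic := fun x _ => analyticAt_const
  decay := by
    intro p N
    simp

theorem IsRapid.add {f g : ℝ → ℂ} (hf : IsRapid f) (hg : IsRapid g) : IsRapid (f + g) where
  zero := fun x hx => by simp [hf.zero x hx, hg.zero x hx]
  analytic := hf.analytic.add hg.analytic
  decay := by
    intro p N
    have h := (hf.decay p N).add (hg.decay p N)
    rw [add_zero] at h
    refine h.congr' ?_
    filter_upwards [Filter.eventually_gt_atTop 0] with x hx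
    rw [iteratedDeriv_add (hf.contDiffAt p hx) (hg.contDiffAt p hx)]
    ring

/-- Multiplication by an analytic function on `(0, ∞)` all of whose derivatives grow at most
polynomially preserves `W`. -/
theorem IsRapid.mul {f g : ℝ → ℂ} (hf : IsRapid f) (hg : AnalyticOnNhd ℝ g (Set.Ioi 0))
    (k : ℕ) (hb : ∀ i : ℕ, ∃ c : ℝ, ∀ x : ℝ, 1 ≤ x → ‖iteratedDeriv i g x‖ ≤ c * x ^ k) :
    IsRapid (g * f) where
  zero := fun x hx => by simp [hf.zero x hx]
  analytic := hg.mul hf.analytic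
  decay := by
    intro p N
    have key : ∀ i ∈ Finset.range (p + 1), Filter.Tendsto (fun x : ℝ =>
        (x : ℂ) ^ N * ((p.choose i : ℂ) * iteratedDeriv i g x * iteratedDeriv (p - i) f x))
        Filter.atTop (𝓝 0) := by
      intro i _
      obtain ⟨c, hc⟩ := hb i
      have h := ((hf.decay (p - i) (N + k)).norm).const_mul ((p.choose i : ℝ) * c)
      rw [norm_zero, mul_zero] at h
      refine squeeze_zero_norm' ?_ h
      filter_upwards [Filter.eventually_ge_atTop 1] with x hx
      have hx0 : 0 ≤ x := by linarith
      simp only [norm_mul, norm_pow, Complex.norm_real, Real.norm_of_nonneg hx0,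
        Complex.norm_natCast]
      calc x ^ N * ((p.choose i : ℝ) * ‖iteratedDeriv i g x‖ * ‖iteratedDeriv (p - i) f x‖)
          ≤ x ^ N * ((p.choose i : ℝ) * (c * x ^ k) * ‖iteratedDeriv (p - i) f x‖) := by
            gcongr
            exact hc x hx
        _ = (p.choose i : ℝ) * c * (x ^ (N + k) * ‖iteratedDeriv (p - i) f x‖) := by ring
    have hs := tendsto_finsetSum _ key
    rw [Finset.sum_const_zero] at hs
    refine hs.congr' ?_
    filter_upwards [Filter.eventually_gt_atTop 0] with x hx
    rw [iteratedDeriv_mul (hg x hx).contDiffAt (hf.contDiffAt p hx), Finset.mul_sum]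

theorem IsRapid.const_mul {f : ℝ → ℂ} (hf : IsRapid f) (c : ℂ) : IsRapid (c • f) := by
  refine hf.mul (g := fun _ => c) (fun x _ => analyticAt_const) 0 (fun i => ⟨‖c‖, fun x _ => ?_⟩)
  rw [iteratedDeriv_const]
  split_ifs <;> simp

theorem IsRapid.deriv {f : ℝ → ℂ} (hf : IsRapid f) : IsRapid (deriv f) where
  zero := by
    intro x hx
    by_cases h : DifferentiableAt ℝ f x
    · have h1 : HasDerivWithinAt f (_root_.deriv f x) (Set.Iic x) x :=
        h.hasDerivAt.hasDerivWithinAt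
      have h2 : HasDerivWithinAt f 0 (Set.Iic x) x :=
        (hasDerivWithinAt_const x (Set.Iic x) (0 : ℂ)).congr
          (fun y hy => hf.zero y (le_trans hy hx)) (hf.zero x hx)
      exact (uniqueDiffWithinAt_Iic x).eq_deriv _ h1 h2
    · exact deriv_zero_of_not_differentiableAt h
  analytic := hf.analytic.deriv
  decay := by
    intro p N
    have h := hf.decay (p + 1) N
    rwa [iteratedDeriv_succ'] at h

theorem IsRapid.mulX {f : ℝ → ℂ} (hf : IsRapid f) : IsRapid ((fun x : ℝ => (x : ℂ)) * f) := by
  have ha : AnalyticOnNhd ℝ (fun x : ℝ => (x : ℂ)) (Set.Ioi 0) :=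
    fun x _ => Complex.ofRealCLM.analyticAt x
  refine hf.mul ha 1 (fun i => ?_)
  have hd : _root_.deriv (fun x : ℝ => (x : ℂ)) = fun _ => 1 := by
    funext x
    exact Complex.ofRealCLM.hasDerivAt.deriv
  rcases i with _ | i
  · exact ⟨1, fun x hx => by simp [abs_of_nonneg (le_trans zero_le_one hx)]⟩
  · refine ⟨1, fun x hx => ?_⟩
    rw [iteratedDeriv_succ', hd, iteratedDeriv_const]
    split_ifs
    · simpa using hx
    · simpa using le_trans zero_le_one hx

theorem IsRapid.mulXinv {f : ℝ → ℂ} (hf : IsRapid f) :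
    IsRapid ((fun x : ℝ => (x : ℂ)⁻¹) * f) := by
  have ha : AnalyticOnNhd ℝ (fun x : ℝ => (x : ℂ)⁻¹) (Set.Ioi 0) :=
    fun x hx => (Complex.ofRealCLM.analyticAt x).inv (by simpa using (ne_of_gt hx))
  have hd : ∀ i : ℕ, ∀ x : ℝ, 0 < x → iteratedDeriv i (fun x : ℝ => (x : ℂ)⁻¹) x =
      (-1) ^ i * (i.factorial : ℂ) * ((x : ℂ)⁻¹) ^ (i + 1) := by
    intro i
    induction i with
    | zero => intro x _; simp
    | succ i ih =>
      intro x hx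
      have hev : iteratedDeriv i (fun x : ℝ => (x : ℂ)⁻¹) =ᶠ[𝓝 x]
          fun x : ℝ => (-1) ^ i * (i.factorial : ℂ) * ((x : ℂ)⁻¹) ^ (i + 1) := by
        filter_upwards [lt_mem_nhds hx] with y hy using ih y hy
      have hx' : (x : ℂ) ≠ 0 := by simpa using hx.ne'
      have h1 : HasDerivAt (fun x : ℝ => (x : ℂ)⁻¹) (-((x : ℂ)⁻¹) ^ 2) x := by
        have h0 : HasDerivAt (fun x : ℝ => (x : ℂ)⁻¹) (-1 / (x : ℂ) ^ 2) x :=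
          Complex.ofRealCLM.hasDerivAt.inv hx'
        convert h0 using 1
        field_simp
      rw [iteratedDeriv_succ, hev.deriv_eq,
        HasDerivAt.deriv
          (HasDerivAt.const_mul ((-1 : ℂ) ^ i * (i.factorial : ℂ)) (h1.fun_pow (i + 1)))]
      push_cast [Nat.factorial_succ]
      ring
  refine hf.mul ha 0 (fun i => ⟨i.factorial, fun x hx => ?_⟩)
  have hx0 : 0 < x := by linarith
  rw [hd i x hx0]
  simp only [norm_mul, norm_pow, norm_neg, norm_one, one_pow, one_mul, Complex.norm_natCast,
    norm_inv, Complex.norm_real, Real.norm_of_nonneg hx0.le, pow_zero]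
  exact mul_le_mul_of_nonneg_left (pow_le_one₀ (by positivity) (inv_le_one_of_one_le₀ hx))
    (by positivity)

/-- The space `W`. -/
def rapidSpace : Submodule ℂ (ℝ → ℂ) where
  carrier := {f | IsRapid f}
  add_mem' := fun hf hg => IsRapid.add hf hg
  zero_mem' := isRapid_zero
  smul_mem' := fun c _ hf => IsRapid.const_mul hf c

/-- The operator `∂ₓ` on `W`. -/
def opD : Module.End ℂ rapidSpace where
  toFun f := ⟨deriv f.1, IsRapid.deriv f.2⟩
  map_add' f g := by
    apply Subtype.ext
    funext x
    rcases le_or_gt x 0 with hx | hx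
    · have h1 := (IsRapid.deriv (f + g).2).zero x hx
      have h2 := (IsRapid.deriv f.2).zero x hx
      have h3 := (IsRapid.deriv g.2).zero x hx
      simpa [h2, h3] using h1
    · exact deriv_add ((IsRapid.analytic f.2 x hx).differentiableAt)
        ((IsRapid.analytic g.2 x hx).differentiableAt)
  map_smul' c f := by
    apply Subtype.ext
    funext x
    exact deriv_const_smul_field c f.1

/-- The operator of multiplication by `x` on `W`. -/
def opX : Module.End ℂ rapidSpace where
  toFun f := ⟨(fun x : ℝ => (x : ℂ)) * f.1, IsRapid.mulX f.2⟩
  map_add' _ _ := Subtype.ext (mul_add _ _ _)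
  map_smul' c _ := Subtype.ext (mul_smul_comm c _ _)

/-- The operator of multiplication by `x⁻¹` on `W`. -/
def opXinv : Module.End ℂ rapidSpace where
  toFun f := ⟨(fun x : ℝ => (x : ℂ)⁻¹) * f.1, IsRapid.mulXinv f.2⟩
  map_add' _ _ := Subtype.ext (mul_add _ _ _)
  map_smul' c _ := Subtype.ext (mul_smul_comm c _ _)

/-! ## The operators -/

/-- `A₁ = x⁻¹`. -/
def opA1 : Module.End ℂ rapidSpace := opXinv

/-- `A₀ = ∂ₓ + ½ x⁻¹`. -/
def opA0 : Module.End ℂ rapidSpace := opD + (1 / 2 : ℂ) • opXinv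

/-- `A(u) = (u - ½) A₁ + A₀ + δ / (u - ½)`. The last term is absent if `δ = 0`; if `δ ≠ 0` the
operator is only used for `u ≠ ½`. -/
def opA (δ u : ℂ) : Module.End ℂ rapidSpace :=
  (u - 1 / 2) • opA1 + opA0 + (δ / (u - 1 / 2)) • 1

/-- `B₀ = x⁻²`. -/
def opB : Module.End ℂ rapidSpace := opXinv ^ 2

/-- `C(u) = -x² ∂ₓ² - x ∂ₓ + ¼ x² + 2 δ x + u²`. -/
def opC (δ u : ℂ) : Module.End ℂ rapidSpace :=
  -(opX ^ 2 * opD ^ 2) - opX * opD + (1 / 4 : ℂ) • opX ^ 2 + (2 * δ) • opX + (u ^ 2) • 1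

/-- `D(u) = (u + 3/2) A₁ - A₀ + δ / (u - ½)`. -/
def opDD (δ u : ℂ) : Module.End ℂ rapidSpace :=
  (u + 3 / 2) • opA1 - opA0 + (δ / (u - 1 / 2)) • 1

/-- The `L`-operator. -/
def opU (δ u : ℂ) : Matrix (Fin 2) (Fin 2) (Module.End ℂ rapidSpace) :=
  !![opA δ u, opB; opC δ u, opDD δ u]

/-- The values of the spectral parameter at which the `L`-operator is defined: all of `ℂ` if
`δ = 0`, and `ℂ ∖ {½}` if `δ ≠ 0`. -/
def spectralSet (δ : ℂ) : Set ℂ := {u | δ = 0 ∨ u ≠ 1 / 2}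

/-! ## Special functions -/

/-- The characterization of Tricomi's function `x ↦ Ψ(a, c; x)` on `(0, ∞)`: it is the
analytic solution of `x f'' + (c - x) f' - a f = 0` of at most polynomial growth at `∞`, normalized
by `f(x) = x^{-a} + O(|x^{-a-1}|)` as `x → ∞`. -/
structure IsTricomiPsi (a c : ℂ) (f : ℝ → ℂ) : Prop where
  analytic : AnalyticOnNhd ℝ f (Set.Ioi 0)
  ode : ∀ x : ℝ, 0 < x →
    (x : ℂ) * iteratedDeriv 2 f x + (c - (x : ℂ)) * deriv f x - a * f x = 0
  growth : ∃ N : ℕ, f =O[Filter.atTop] fun x : ℝ => x ^ N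
  normalized : (fun x : ℝ => f x - (x : ℂ) ^ (-a)) =O[Filter.atTop] fun x : ℝ => (x : ℂ) ^ (-a - 1)

open Classical in
/-- Tricomi's function `Ψ(a, c; x)` for `x > 0` and arbitrary complex `a`, `c`, defined by its
characterization (with the value `0` if there were no such function). -/
def tricomiPsi (a c : ℂ) (x : ℝ) : ℂ :=
  if h : ∃ f, IsTricomiPsi a c f then h.choose x else 0

/-- The Laguerre polynomial
`L_n^{(α)}(X) = ∑_{k ≤ n} (α + k + 1)_{n-k} / (n-k)! * (-X)^k / k!`. -/
def laguerrePoly (n : ℕ) (α : ℂ) : Polynomial ℂ :=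
  ∑ k ∈ Finset.range (n + 1), Polynomial.monomial k
    ((-1) ^ k * (ascPochhammer ℂ (n - k)).eval (α + k + 1) /
      ((n - k).factorial * k.factorial : ℂ))

/-- The values of `F` at `u` are a Laguerre polynomial times an exponential and a power: for some
`n`, `u = -2δ - ½ - n` and `F(u)(x) = (-1)ⁿ n! x^u e^{-x/2} L_n^{(2u)}(x)`; equivalently `F(u)(x)`
is `(-1)ⁿ n! x^{-2δ-1/2} e^{-x/2}` times the value at `x⁻¹` of the polynomial with the reversed
list of coefficients. -/
def IsLaguerreForm (δ u : ℂ) (f : rapidSpace) : Prop :=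
  ∃ n : ℕ, u = -2 * δ - 1 / 2 - n ∧ ∀ x : ℝ, 0 < x →
    f.1 x = (-1) ^ n * (n.factorial : ℂ) * (x : ℂ) ^ u * Complex.exp (-(x : ℂ) / 2) *
        (laguerrePoly n (2 * u)).eval (x : ℂ) ∧
    f.1 x = (-1) ^ n * (n.factorial : ℂ) * (x : ℂ) ^ (-2 * δ - 1 / 2) *
        Complex.exp (-(x : ℂ) / 2) * (laguerrePoly n (2 * u)).reverse.eval ((x : ℂ)⁻¹)

end

/-!
Put `κ = δ / (u - ½)`. The operators `A(u)`, `D(u)` and `C(u)` are polynomials in `Y = x⁻¹`,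
`D = ∂ₓ` and `C = C(0)`, whose commutators, together with an expression for `D * D`, bring any such
polynomial into normal form; the reflection equation becomes a comparison of coefficients.

Tricomi's function is the Laplace integral `Γ(a)⁻¹ ∫ e^{-xt} t^{a-1} (1+t)^{c-a-1} dt` if
`0 < Re a`, and the contiguous relation that lowers `a` carries it to all other `a`. Solutions of
`C(u) w = 0` with rapid decay are unique up to a scalar by Abel's identity: `x` times the Wronskian
is constant and tends to zero. Hence `F(u)` spans the null space of `C(u)`.

The end points of the ladders come from the factorization
`((u - 1) Y - D + κ) A(u) = Y² C(u) + κ² - ¼`: if `A(u)` annihilates `F(u)`, then `κ = ±½`. The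
solution of `A(u) w = 0` is a multiple of `x^{-u} e^{-κ x}`, which decays for `κ = ½` only. As
`Ψ(0, c; x) = 1`, this function is then `F(-u)`, which is proportional to `F(u)`. So `A(u)`
annihilates the null space of `C(u)` exactly if `u = 2δ + ½`.
-/

section Analysis

open MeasureTheory Set Filter Asymptotics

/-! ### Complex powers and polynomial growth -/

/-- `f` grows at most polynomially at `∞`. -/
def HasPolyGrowth (f : ℝ → ℂ) : Prop :=
  ∃ N : ℕ, f =O[atTop] fun x : ℝ => x ^ N

theorem hasPolyGrowth_const (k : ℂ) : HasPolyGrowth fun _ => k :=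
  ⟨0, by simpa only [pow_zero] using isBigO_const_const k one_ne_zero atTop⟩

theorem HasPolyGrowth.mul {f g : ℝ → ℂ} (hf : HasPolyGrowth f) (hg : HasPolyGrowth g) :
    HasPolyGrowth fun x => f x * g x := by
  obtain ⟨M, hM⟩ := hf
  obtain ⟨N, hN⟩ := hg
  exact ⟨M + N, by simpa only [pow_add] using hM.mul hN⟩

theorem HasPolyGrowth.add {f g : ℝ → ℂ} (hf : HasPolyGrowth f) (hg : HasPolyGrowth g) :
    HasPolyGrowth fun x => f x + g x := by
  obtain ⟨M, hM⟩ := hf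
  obtain ⟨N, hN⟩ := hg
  have pow_isBigO : ∀ {m n : ℕ}, m ≤ n → (fun x : ℝ => x ^ m) =O[atTop] fun x => x ^ n :=
    fun h => IsBigO.of_bound' <| (eventually_ge_atTop 1).mono fun x hx => by
      rw [norm_pow, norm_pow]
      exact pow_le_pow_right₀ (hx.trans (Real.le_norm_self x)) h
  exact ⟨max M N, (hM.trans (pow_isBigO (le_max_left M N))).add
    (hN.trans (pow_isBigO (le_max_right M N)))⟩

theorem norm_ofReal_cpow (a : ℂ) {x : ℝ} (hx : 0 < x) : ‖(x : ℂ) ^ a‖ = x ^ a.re :=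
  Complex.norm_cpow_eq_rpow_re_of_pos hx a

theorem ofReal_mul_cpow (a : ℂ) {x : ℝ} (hx : 0 < x) :
    (x : ℂ) * (x : ℂ) ^ a = (x : ℂ) ^ (a + 1) := by
  rw [Complex.cpow_add _ _ (Complex.ofReal_ne_zero.2 hx.ne'), Complex.cpow_one, mul_comm]

theorem isBigO_cpow_rpow (a : ℂ) :
    (fun x : ℝ => x ^ a.re) =O[atTop] fun x : ℝ => (x : ℂ) ^ a :=
  IsBigO.of_bound' <| (eventually_gt_atTop 0).mono fun x hx => by
    rw [norm_ofReal_cpow a hx, Real.norm_of_nonneg (Real.rpow_nonneg hx.le _)]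

theorem isBigO_cpow_of_re_le {a b : ℂ} (h : a.re ≤ b.re) :
    (fun x : ℝ => (x : ℂ) ^ a) =O[atTop] fun x : ℝ => (x : ℂ) ^ b := by
  refine IsBigO.of_bound' ((eventually_ge_atTop 1).mono fun x hx => ?_)
  rw [norm_ofReal_cpow a (one_pos.trans_le hx), norm_ofReal_cpow b (one_pos.trans_le hx)]
  exact Real.rpow_le_rpow_of_exponent_le hx h

theorem hasPolyGrowth_cpow (a : ℂ) : HasPolyGrowth fun x => (x : ℂ) ^ a := by
  obtain ⟨N, hN⟩ := exists_nat_ge a.re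
  refine ⟨N, (isBigO_cpow_of_re_le (b := (N : ℂ)) (by simpa using hN)).trans
    (IsBigO.of_bound' (Eventually.of_forall fun x => ?_))⟩
  rw [Complex.cpow_natCast, norm_pow, norm_pow, Complex.norm_real]

theorem HasPolyGrowth.of_isBigO_cpow {f : ℝ → ℂ} {a : ℂ}
    (h : f =O[atTop] fun x : ℝ => (x : ℂ) ^ a) : HasPolyGrowth f :=
  let ⟨N, hN⟩ := hasPolyGrowth_cpow a
  ⟨N, h.trans hN⟩

theorem hasPolyGrowth_inv : HasPolyGrowth fun x => (x : ℂ)⁻¹ := by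
  simpa only [Complex.cpow_neg_one] using hasPolyGrowth_cpow (-1)

theorem hasDerivAt_ofReal (x : ℝ) : HasDerivAt (fun x : ℝ => (x : ℂ)) 1 x :=
  Complex.ofRealCLM.hasDerivAt

theorem analyticOnNhd_ofReal (s : Set ℝ) : AnalyticOnNhd ℝ (fun x : ℝ => (x : ℂ)) s :=
  fun x _ => Complex.ofRealCLM.analyticAt x

theorem hasDerivAt_cpow_of_pos {f : ℝ → ℝ} {f' x : ℝ} (b : ℂ) (hf : HasDerivAt f f' x)
    (hx : 0 < f x) :
    HasDerivAt (fun x => (f x : ℂ) ^ b) (b * (f x : ℂ) ^ (b - 1) * f') x := by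
  have h := (hasDerivAt_id (f x : ℂ)).cpow_const (c := b)
    (Complex.ofReal_mem_slitPlane.2 hx)
  exact (h.comp x hf.ofReal_comp).congr_deriv (by rw [mul_one])

/-- The weight `x ^ u * exp (-b x)`; it relates the confluent hypergeometric equation to the
self-adjoint form and to Whittaker's form. -/
noncomputable def cpowExp (u b : ℂ) (x : ℝ) : ℂ :=
  (x : ℂ) ^ u * Complex.exp (-(b * x))

theorem cpowExp_ne_zero (u b : ℂ) {x : ℝ} (hx : 0 < x) : cpowExp u b x ≠ 0 :=
  mul_ne_zero (by simp [Complex.cpow_eq_zero_iff, hx.ne']) (Complex.exp_ne_zero _)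

theorem hasDerivAt_cpowExp (u b : ℂ) {x : ℝ} (hx : 0 < x) :
    HasDerivAt (cpowExp u b) ((u * (x : ℂ)⁻¹ - b) * cpowExp u b x) x := by
  have hx' : (x : ℂ) ≠ 0 := Complex.ofReal_ne_zero.2 hx.ne'
  refine ((hasDerivAt_cpow_of_pos u (hasDerivAt_id x) hx).mul
    ((hasDerivAt_ofReal x).const_mul b).fun_neg.cexp).congr_deriv ?_
  simp only [id, cpowExp, Complex.cpow_sub _ _ hx', Complex.cpow_one, Complex.ofReal_one]
  ring

theorem analyticOnNhd_cpowExp (u b : ℂ) : AnalyticOnNhd ℝ (cpowExp u b) (Ioi 0) := by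
  intro x hx
  have hcpow : AnalyticAt ℝ (fun z : ℂ => z ^ u) (x : ℂ) :=
    (analyticAt_id.cpow analyticAt_const (Complex.ofReal_mem_slitPlane.2 hx)).restrictScalars
  have hexp : AnalyticAt ℝ (fun z : ℂ => Complex.exp (-(b * z))) (x : ℂ) :=
    (analyticAt_const.mul analyticAt_id).neg.cexp.restrictScalars
  exact (hcpow.mul hexp).comp (f := fun x : ℝ => (x : ℂ)) (Complex.ofRealCLM.analyticAt x)

theorem tendsto_cpowExp_mul (u : ℂ) {b : ℂ} (hb : 0 < b.re) {g : ℝ → ℂ} (hg : HasPolyGrowth g) :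
    Tendsto (fun x => cpowExp u b x * g x) atTop (𝓝 0) := by
  obtain ⟨N, hN⟩ := hg
  have hweight : cpowExp u b =O[atTop] fun x : ℝ => x ^ u.re * Real.exp (-b.re * x) :=
    IsBigO.of_bound' <| (eventually_gt_atTop 0).mono fun x hx => by
      rw [cpowExp, norm_mul, norm_ofReal_cpow u hx, Complex.norm_exp, norm_mul,
        Real.norm_of_nonneg (Real.rpow_nonneg hx.le _), Real.norm_of_nonneg (Real.exp_pos _).le]
      simp
  refine (hweight.mul hN).trans_tendsto
    ((tendsto_rpow_mul_exp_neg_mul_atTop_nhds_zero (u.re + N) b.re hb).congr' ?_)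
  filter_upwards [eventually_gt_atTop 0] with x hx
  rw [Real.rpow_add hx, Real.rpow_natCast]
  ring

/-! ### Laplace transforms -/

/-- `p` is measurable on `(0, ∞)` and, for every `ε > 0`, bounded there by a multiple of
`t ^ (s - 1) * exp (ε t)`. For `s > 0` its Laplace transform then exists on the right half plane
and is `O(x ^ (-s))` at `∞`. -/
structure HasLaplaceBound (s : ℝ) (p : ℝ → ℂ) : Prop where
  meas : AEStronglyMeasurable p (volume.restrict (Ioi 0))
  isBigO : ∀ ε : ℝ, 0 < ε →
    p =O[𝓟 (Ioi 0)] fun t : ℝ => t ^ (s - 1) * Real.exp (ε * t)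

/-- The Laplace transform of `p` on `(0, ∞)`; its value is `0` where the integral diverges. -/
noncomputable def laplace (p : ℝ → ℂ) (z : ℂ) : ℂ :=
  ∫ t in Ioi (0 : ℝ), Complex.exp (-(z * t)) * p t

theorem integrableOn_rpow_mul_exp {s r : ℝ} (hs : 0 < s) (hr : 0 < r) :
    IntegrableOn (fun t : ℝ => t ^ (s - 1) * Real.exp (-(r * t))) (Ioi 0) := by
  simpa using integrableOn_rpow_mul_exp_neg_mul_rpow (p := 1) (s := s - 1) (by linarith)
    one_pos hr

theorem laplace_congr {p q : ℝ → ℂ} (h : ∀ t : ℝ, 0 < t → p t = q t) (z : ℂ) :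
    laplace p z = laplace q z :=
  setIntegral_congr_fun measurableSet_Ioi fun t ht => by rw [h t ht]

theorem laplace_const_mul (k : ℂ) (p : ℝ → ℂ) (z : ℂ) :
    laplace (fun t => k * p t) z = k * laplace p z := by
  simp only [laplace, mul_left_comm _ k, integral_const_mul]

theorem laplace_add {p q : ℝ → ℂ} {z : ℂ}
    (hp : IntegrableOn (fun t : ℝ => Complex.exp (-(z * t)) * p t) (Ioi 0))
    (hq : IntegrableOn (fun t : ℝ => Complex.exp (-(z * t)) * q t) (Ioi 0)) :
    laplace (fun t => p t + q t) z = laplace p z + laplace q z := by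
  simp only [laplace, mul_add, integral_add hp hq]

namespace HasLaplaceBound

variable {s : ℝ} {p : ℝ → ℂ}

theorem exists_norm_exp_mul_le (h : HasLaplaceBound s p) {ε : ℝ} (hε : 0 < ε) :
    ∃ C : ℝ, 0 ≤ C ∧ ∀ (z : ℂ) (r : ℝ), r ≤ z.re - ε → ∀ t : ℝ, 0 < t →
      ‖Complex.exp (-(z * t)) * p t‖ ≤ C * (t ^ (s - 1) * Real.exp (-(r * t))) := by
  obtain ⟨C, hC0, hC⟩ := (h.isBigO ε hε).exists_nonneg
  refine ⟨C, hC0, fun z r hr t ht => ?_⟩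
  have hp := isBigOWith_principal.1 hC t ht
  have ht' : 0 ≤ t ^ (s - 1) := Real.rpow_nonneg ht.le _
  rw [Real.norm_of_nonneg (by positivity)] at hp
  calc ‖Complex.exp (-(z * t)) * p t‖
      ≤ Real.exp (-(z * t)).re * (C * (t ^ (s - 1) * Real.exp (ε * t))) := by
        rw [norm_mul, Complex.norm_exp]; gcongr
    _ = C * (t ^ (s - 1) * Real.exp (-((z.re - ε) * t))) := by
        rw [show -((z.re - ε) * t) = (-(z * t)).re + ε * t by simp; ring, Real.exp_add]
        ring
    _ ≤ C * (t ^ (s - 1) * Real.exp (-(r * t))) := by gcongr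

theorem aestronglyMeasurable_exp_mul (h : HasLaplaceBound s p) (z : ℂ) :
    AEStronglyMeasurable (fun t : ℝ => Complex.exp (-(z * t)) * p t) (volume.restrict (Ioi 0)) :=
  (Continuous.aestronglyMeasurable (by fun_prop)).mul h.meas

theorem integrableOn (hs : 0 < s) (h : HasLaplaceBound s p) {z : ℂ} (hz : 0 < z.re) :
    IntegrableOn (fun t : ℝ => Complex.exp (-(z * t)) * p t) (Ioi 0) := by
  obtain ⟨C, -, hC⟩ := h.exists_norm_exp_mul_le (half_pos hz)
  refine Integrable.mono' ((integrableOn_rpow_mul_exp hs (half_pos hz)).const_mul C)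
    (h.aestronglyMeasurable_exp_mul z) ?_
  exact ae_restrict_of_forall_mem measurableSet_Ioi (hC z _ (by linarith))

theorem laplace_isBigO (hs : 0 < s) (h : HasLaplaceBound s p) :
    (fun x : ℝ => laplace p x) =O[atTop] fun x : ℝ => x ^ (-s) := by
  obtain ⟨C, -, hC⟩ := h.exists_norm_exp_mul_le one_half_pos
  refine IsBigO.of_bound (C * (2 ^ s * Real.Gamma s)) ?_
  filter_upwards [eventually_ge_atTop 1] with x hx
  have hx0 : 0 < x := one_pos.trans_le hx
  calc ‖laplace p x‖
      ≤ ∫ t in Ioi (0 : ℝ), C * (t ^ (s - 1) * Real.exp (-(x / 2 * t))) :=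
        norm_integral_le_of_norm_le ((integrableOn_rpow_mul_exp hs (half_pos hx0)).const_mul C)
          (ae_restrict_of_forall_mem measurableSet_Ioi
            (hC x _ (by rw [Complex.ofReal_re]; linarith)))
    _ = C * (2 ^ s * Real.Gamma s) * ‖x ^ (-s)‖ := by
        rw [integral_const_mul, Real.integral_rpow_mul_exp_neg_mul_Ioi hs (half_pos hx0),
          Real.norm_of_nonneg (by positivity), one_div_div, Real.div_rpow two_pos.le hx0.le,
          Real.rpow_neg hx0.le]
        ring

theorem mul_id (h : HasLaplaceBound s p) : HasLaplaceBound (s + 1) fun t => (t : ℂ) * p t where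
  meas := (Continuous.aestronglyMeasurable (by fun_prop)).mul h.meas
  isBigO ε hε := by
    have hid : (fun t : ℝ => (t : ℂ)) =O[𝓟 (Ioi 0)] fun t : ℝ => t :=
      IsBigO.of_bound' (Eventually.of_forall fun t => (Complex.norm_real t).le)
    refine (hid.mul (h.isBigO ε hε)).congr' EventuallyEq.rfl (eventually_principal.2 fun t ht => ?_)
    beta_reduce
    rw [add_sub_right_comm, Real.rpow_add_one (ne_of_gt ht)]
    ring

theorem const_mul (h : HasLaplaceBound s p) (k : ℂ) : HasLaplaceBound s fun t => k * p t where
  meas := h.meas.const_mul k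
  isBigO ε hε := (h.isBigO ε hε).const_mul_left k

theorem hasDerivAt_laplace (hs : 0 < s) (h : HasLaplaceBound s p) {z : ℂ} (hz : 0 < z.re) :
    HasDerivAt (laplace p) (-laplace (fun t => (t : ℂ) * p t) z) z := by
  obtain ⟨C, -, hC⟩ := h.mul_id.exists_norm_exp_mul_le (ε := z.re / 4) (by linarith)
  have hU : {w : ℂ | z.re / 2 < w.re} ∈ 𝓝 z :=
    (isOpen_lt continuous_const Complex.continuous_re).mem_nhds (half_lt_self hz)
  have key := (hasDerivAt_integral_of_dominated_loc_of_deriv_le (μ := volume.restrict (Ioi 0))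
    (F := fun w t => Complex.exp (-(w * t)) * p t)
    (F' := fun w t => -(Complex.exp (-(w * t)) * ((t : ℂ) * p t)))
    (bound := fun t => C * (t ^ (s + 1 - 1) * Real.exp (-(z.re / 4 * t))))
    hU (Eventually.of_forall h.aestronglyMeasurable_exp_mul) (h.integrableOn hs hz)
    (h.mul_id.aestronglyMeasurable_exp_mul z).neg
    (ae_restrict_of_forall_mem measurableSet_Ioi fun t ht w hw => ?_)
    ((integrableOn_rpow_mul_exp (by linarith) (by linarith)).const_mul C)
    (Eventually.of_forall fun t w _ => ?_)).2
  · rwa [integral_neg] at key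
  · rw [norm_neg]
    exact hC w _ (by linarith [show z.re / 2 < w.re from hw]) t ht
  · refine ((((hasDerivAt_id w).mul_const (t : ℂ)).fun_neg.cexp).mul_const (p t)).congr_deriv ?_
    simp only [id]
    ring

theorem hasDerivAt_laplace_ofReal (hs : 0 < s) (h : HasLaplaceBound s p) {x : ℝ} (hx : 0 < x) :
    HasDerivAt (fun y : ℝ => laplace p y) (-laplace (fun t => (t : ℂ) * p t) x) x :=
  (h.hasDerivAt_laplace hs (z := x) (by simpa using hx)).comp_ofReal

theorem analyticOnNhd_laplace (hs : 0 < s) (h : HasLaplaceBound s p) :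
    AnalyticOnNhd ℝ (fun y : ℝ => laplace p y) (Ioi 0) := by
  have hright : AnalyticOnNhd ℂ (laplace p) {w : ℂ | 0 < w.re} :=
    DifferentiableOn.analyticOnNhd
      (fun z hz => (h.hasDerivAt_laplace hs hz).differentiableAt.differentiableWithinAt)
      (isOpen_lt continuous_const Complex.continuous_re)
  exact fun x hx => (hright.restrictScalars (𝕜 := ℝ) (x : ℂ) (by simpa using hx)).comp
    (Complex.ofRealCLM.analyticAt x)

theorem tendsto_exp_mul_nhdsGT_zero (hs : 1 < s) (h : HasLaplaceBound s p) (z : ℂ) :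
    Tendsto (fun t : ℝ => Complex.exp (-(z * t)) * p t) (𝓝[>] 0) (𝓝 0) := by
  have hp : p =O[𝓝[>] 0] fun t : ℝ => t ^ (s - 1) * Real.exp (1 * t) :=
    (h.isBigO 1 one_pos).mono inf_le_right
  have hlim : Tendsto (fun t : ℝ => t ^ (s - 1) * Real.exp (1 * t)) (𝓝[>] 0) (𝓝 0) := by
    have hcont : ContinuousAt (fun t : ℝ => t ^ (s - 1) * Real.exp (1 * t)) 0 :=
      (Real.continuousAt_rpow_const _ _ (Or.inr (by linarith))).mul (by fun_prop)
    simpa [Real.zero_rpow (sub_ne_zero.2 hs.ne')] using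
      hcont.tendsto.mono_left nhdsWithin_le_nhds
  have hexp : Tendsto (fun t : ℝ => Complex.exp (-(z * t))) (𝓝[>] 0) (𝓝 1) := by
    have hcont : Continuous fun t : ℝ => Complex.exp (-(z * t)) := by fun_prop
    simpa using (hcont.tendsto 0).mono_left nhdsWithin_le_nhds
  simpa using hexp.mul (hp.trans_tendsto hlim)

theorem tendsto_exp_mul_atTop (h : HasLaplaceBound s p) {z : ℂ} (hz : 0 < z.re) :
    Tendsto (fun t : ℝ => Complex.exp (-(z * t)) * p t) atTop (𝓝 0) := by
  obtain ⟨C, -, hC⟩ := h.exists_norm_exp_mul_le (half_pos hz)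
  have hlim := (tendsto_rpow_mul_exp_neg_mul_atTop_nhds_zero (s - 1) (z.re / 2)
    (half_pos hz)).const_mul C
  rw [mul_zero] at hlim
  refine squeeze_zero_norm' ((eventually_gt_atTop 0).mono fun t ht => ?_) hlim
  rw [neg_mul]
  exact hC z _ (by linarith) t ht

theorem mul_laplace (hs : 1 < s) (h : HasLaplaceBound s p) {p' : ℝ → ℂ}
    (hp' : ∀ t ∈ Ioi (0 : ℝ), HasDerivAt p (p' t) t) {z : ℂ} (hz : 0 < z.re)
    (hint : IntegrableOn (fun t : ℝ => Complex.exp (-(z * t)) * p' t) (Ioi 0)) :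
    z * laplace p z = laplace p' z := by
  have hexp : ∀ t ∈ Ioi (0 : ℝ), HasDerivAt (fun t : ℝ => Complex.exp (-(z * t)))
      (-z * Complex.exp (-(z * t))) t := fun t _ =>
    ((hasDerivAt_ofReal t).const_mul z).fun_neg.cexp.congr_deriv (by ring)
  have key := integral_Ioi_mul_deriv_eq_deriv_mul (a' := 0) (b' := 0) hexp hp' hint
    (by simpa only [IntegrableOn, Pi.mul_def, mul_assoc] using
      (h.integrableOn (one_pos.trans hs) hz).const_mul (-z))
    (h.tendsto_exp_mul_nhdsGT_zero hs z) (h.tendsto_exp_mul_atTop hz)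
  simp only [mul_assoc, integral_const_mul] at key
  simpa [laplace] using key.symm

end HasLaplaceBound

theorem laplace_cpow {a : ℂ} (ha : 0 < a.re) {x : ℝ} (hx : 0 < x) :
    laplace (fun t : ℝ => (t : ℂ) ^ (a - 1)) x = Complex.Gamma a * (x : ℂ) ^ (-a) := by
  have h := Complex.integral_cpow_mul_exp_neg_mul_Ioi ha (r := x) (by simpa using hx)
  simp only [laplace, mul_comm (Complex.exp _), h]
  have harg : (x : ℂ).arg ≠ Real.pi := by
    rw [Complex.arg_ofReal_of_nonneg hx.le]
    exact Real.pi_pos.ne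
  rw [one_div, Complex.inv_cpow _ _ harg, Complex.cpow_neg, mul_comm]

end Analysis

section Tricomi

open MeasureTheory Set Filter Asymptotics

/-! ### The integral representation of Tricomi's function -/

theorem isBigO_one_add_cpow (b : ℂ) {ε : ℝ} (hε : 0 < ε) :
    (fun t : ℝ => ((1 + t : ℝ) : ℂ) ^ b) =O[𝓟 (Ici 0)] fun t : ℝ => Real.exp (ε * t) := by
  obtain ⟨n, hn⟩ := exists_nat_ge b.re
  refine IsBigO.of_bound (n.factorial / ε ^ n * Real.exp ε) (eventually_principal.2 fun t ht => ?_)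
  have ht' : 0 ≤ t := ht
  have ht1 : 0 < 1 + t := by positivity
  calc ‖((1 + t : ℝ) : ℂ) ^ b‖ = (1 + t) ^ b.re := norm_ofReal_cpow b ht1
    _ ≤ (1 + t) ^ n := by
        rw [← Real.rpow_natCast]
        exact Real.rpow_le_rpow_of_exponent_le (le_add_of_nonneg_right ht') hn
    _ = n.factorial / ε ^ n * ((ε * (1 + t)) ^ n / n.factorial) := by
        rw [mul_pow]
        field_simp
    _ ≤ n.factorial / ε ^ n * Real.exp (ε * (1 + t)) := by
        gcongr
        exact Real.pow_div_factorial_le_exp _ (by positivity) n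
    _ = n.factorial / ε ^ n * Real.exp ε * ‖Real.exp (ε * t)‖ := by
        rw [Real.norm_of_nonneg (Real.exp_pos _).le, mul_one_add, Real.exp_add, mul_assoc]

theorem hasDerivAt_one_add_cpow (b : ℂ) {t : ℝ} (ht : 0 < 1 + t) :
    HasDerivAt (fun t : ℝ => ((1 + t : ℝ) : ℂ) ^ b) (b * ((1 + t : ℝ) : ℂ) ^ (b - 1)) t :=
  (hasDerivAt_cpow_of_pos b ((hasDerivAt_id t).const_add 1) ht).congr_deriv (by simp)

theorem isBigO_one_add_cpow_sub_one (b : ℂ) {ε : ℝ} (hε : 0 < ε) :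
    (fun t : ℝ => ((1 + t : ℝ) : ℂ) ^ b - 1) =O[𝓟 (Ioi 0)] fun t : ℝ => t * Real.exp (ε * t) := by
  obtain ⟨C, hC0, hC⟩ := ((isBigO_one_add_cpow (b - 1) hε).const_mul_left b).exists_nonneg
  refine IsBigO.of_bound C (eventually_principal.2 fun t ht => ?_)
  have hderiv : ∀ y ∈ Icc 0 t, HasDerivWithinAt (fun t : ℝ => ((1 + t : ℝ) : ℂ) ^ b)
      (b * ((1 + y : ℝ) : ℂ) ^ (b - 1)) (Icc 0 t) y := fun y hy =>
    (hasDerivAt_one_add_cpow b (add_pos_of_pos_of_nonneg one_pos hy.1)).hasDerivWithinAt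
  have hbound : ∀ y ∈ Ico 0 t, ‖b * ((1 + y : ℝ) : ℂ) ^ (b - 1)‖ ≤ C * Real.exp (ε * t) := by
    intro y hy
    refine (isBigOWith_principal.1 hC y hy.1).trans ?_
    rw [Real.norm_of_nonneg (Real.exp_pos _).le]
    gcongr
    exact hy.2.le
  have hle := norm_image_sub_le_of_norm_deriv_le_segment' hderiv hbound t
    (right_mem_Icc.2 (le_of_lt ht))
  rw [norm_mul, Real.norm_of_nonneg (le_of_lt ht), Real.norm_of_nonneg (Real.exp_pos _).le]
  simpa [mul_assoc, mul_comm, mul_left_comm] using hle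

/-- The density `t ^ (a - 1) * (1 + t) ^ b` of which, for `b = c - a - 1`, Tricomi's function is
`Γ(a)⁻¹` times the Laplace transform. -/
noncomputable def tricomiDensity (a b : ℂ) (t : ℝ) : ℂ :=
  (t : ℂ) ^ (a - 1) * ((1 + t : ℝ) : ℂ) ^ b

theorem hasLaplaceBound_cpow_mul {a : ℂ} {r : ℝ} {g : ℝ → ℂ} (hg : Measurable g)
    (hb : ∀ ε : ℝ, 0 < ε → g =O[𝓟 (Ioi 0)] fun t : ℝ => t ^ r * Real.exp (ε * t)) :
    HasLaplaceBound (a.re + r) fun t : ℝ => (t : ℂ) ^ (a - 1) * g t where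
  meas := ((Complex.measurable_ofReal.pow_const _).mul hg).aestronglyMeasurable
  isBigO ε hε := by
    have hpow : (fun t : ℝ => (t : ℂ) ^ (a - 1)) =O[𝓟 (Ioi 0)] fun t : ℝ => t ^ (a - 1).re :=
      IsBigO.of_bound' (eventually_principal.2 fun t ht => by
        rw [norm_ofReal_cpow _ ht, Real.norm_of_nonneg (Real.rpow_nonneg (le_of_lt ht) _)])
    refine (hpow.mul (hb ε hε)).congr' EventuallyEq.rfl (eventually_principal.2 fun t ht => ?_)
    beta_reduce
    rw [add_sub_right_comm, Real.rpow_add ht, Complex.sub_re, Complex.one_re, mul_assoc]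

theorem measurable_one_add_cpow (b : ℂ) : Measurable fun t : ℝ => ((1 + t : ℝ) : ℂ) ^ b :=
  (Complex.measurable_ofReal.comp (measurable_id.const_add 1)).pow_const b

theorem hasLaplaceBound_tricomiDensity (a b : ℂ) :
    HasLaplaceBound a.re (tricomiDensity a b) := by
  have hb : ∀ ε : ℝ, 0 < ε → (fun t : ℝ => ((1 + t : ℝ) : ℂ) ^ b) =O[𝓟 (Ioi 0)]
      fun t : ℝ => t ^ (0 : ℝ) * Real.exp (ε * t) := fun ε hε => by
    simpa only [Real.rpow_zero, one_mul] using
      (isBigO_one_add_cpow b hε).mono (principal_mono.2 Ioi_subset_Ici_self)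
  have h := hasLaplaceBound_cpow_mul (a := a) (measurable_one_add_cpow b) hb
  rwa [add_zero] at h

theorem hasLaplaceBound_tricomiDensity_sub (a b : ℂ) :
    HasLaplaceBound (a.re + 1) fun t : ℝ => tricomiDensity a b t - (t : ℂ) ^ (a - 1) := by
  simpa only [tricomiDensity, mul_sub, mul_one] using
    hasLaplaceBound_cpow_mul (a := a) (r := 1) ((measurable_one_add_cpow b).sub_const 1)
      fun ε hε => by simpa using isBigO_one_add_cpow_sub_one b hε

theorem tricomiDensity_add_one (a b : ℂ) {t : ℝ} (ht : 0 < t) :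
    tricomiDensity (a + 1) (b + 1) t =
      t * tricomiDensity a b t + t * (t * tricomiDensity a b t) := by
  have ht1 : ((1 + t : ℝ) : ℂ) ≠ 0 := Complex.ofReal_ne_zero.2 (by positivity)
  have ht0 : (t : ℂ) ≠ 0 := Complex.ofReal_ne_zero.2 ht.ne'
  rw [tricomiDensity, tricomiDensity, add_sub_right_comm, Complex.cpow_add _ _ ht0,
    Complex.cpow_add _ _ ht1, Complex.cpow_one, Complex.cpow_one]
  push_cast
  ring

theorem hasDerivAt_tricomiDensity_add_one (a c : ℂ) {t : ℝ} (ht : 0 < t) :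
    HasDerivAt (tricomiDensity (a + 1) (c - a - 1 + 1))
      (a * tricomiDensity a (c - a - 1) t + c * (t * tricomiDensity a (c - a - 1) t)) t := by
  have ht1 : 0 < 1 + t := by positivity
  refine ((hasDerivAt_cpow_of_pos (a + 1 - 1) (hasDerivAt_id t) ht).mul
    (hasDerivAt_one_add_cpow (c - a - 1 + 1) ht1)).congr_deriv ?_
  have e1 := ofReal_mul_cpow (a - 1) ht
  have e2 := ofReal_mul_cpow (c - a - 1) ht1
  simp only [id, tricomiDensity, add_sub_cancel_right, Complex.ofReal_one] at *
  rw [sub_add_cancel] at e1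
  rw [← e1, ← e2]
  push_cast
  ring

theorem laplace_tricomiDensity_ode {a : ℂ} (c : ℂ) (ha : 0 < a.re) {x : ℝ} (hx : 0 < x) :
    (x : ℂ) * laplace (fun t => t * (t * tricomiDensity a (c - a - 1) t)) x +
      (c - x) * -laplace (fun t => t * tricomiDensity a (c - a - 1) t) x -
      a * laplace (tricomiDensity a (c - a - 1)) x = 0 := by
  have hp := hasLaplaceBound_tricomiDensity a (c - a - 1)
  have hq := hasLaplaceBound_tricomiDensity (a + 1) (c - a - 1 + 1)
  have hxr : 0 < (x : ℂ).re := by rwa [Complex.ofReal_re]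
  have i0 := (hp.const_mul a).integrableOn ha hxr
  have i1 := hp.mul_id.integrableOn (by linarith) hxr
  have i1' := (hp.mul_id.const_mul c).integrableOn (by linarith) hxr
  have i2 := hp.mul_id.mul_id.integrableOn (by linarith) hxr
  have key := hq.mul_laplace (by rw [Complex.add_re, Complex.one_re]; linarith)
    (fun t ht => hasDerivAt_tricomiDensity_add_one a c ht) hxr
    (by simp only [mul_add]; exact i0.add i1')
  rw [laplace_congr fun t ht => tricomiDensity_add_one a (c - a - 1) ht, laplace_add i1 i2,
    laplace_add i0 i1', laplace_const_mul, laplace_const_mul] at key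
  linear_combination key

/-! ### Wronskians -/

theorem eq_zero_of_tendsto_deriv {r r' : ℝ → ℂ} {K : ℂ} (hr : Tendsto r atTop (𝓝 0))
    (hd : ∀ x : ℝ, 0 < x → HasDerivAt r (r' x) x) (hr' : Tendsto r' atTop (𝓝 K)) : K = 0 := by
  have hdiff : Tendsto (fun x : ℝ => r (x + 1) - r x - K) atTop (𝓝 0) := by
    refine Metric.tendsto_atTop'.2 fun ε hε => ?_
    obtain ⟨A, hA⟩ := eventually_atTop.1 ((Metric.tendsto_nhds.1 hr' (ε / 2) (half_pos hε)).and
      (eventually_gt_atTop 0))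
    refine ⟨A, fun x hx => ?_⟩
    have hmean := norm_image_sub_le_of_norm_deriv_le_segment' (a := x) (b := x + 1)
      (f := fun y : ℝ => r y - y * K) (C := ε / 2)
      (fun y hy => ((hd y (hA y (hx.le.trans hy.1)).2).sub
        ((hasDerivAt_ofReal y).mul_const K)).hasDerivWithinAt)
      (fun y hy => by
        simpa [dist_eq_norm] using (hA y (hx.le.trans hy.1)).1.le) (x + 1)
      (right_mem_Icc.2 (by linarith))
    rw [dist_zero_right]
    refine lt_of_le_of_lt (le_of_eq_of_le ?_ hmean) (by linarith)
    congr 1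
    push_cast
    ring
  have hshift := (hr.comp (tendsto_atTop_add_const_right atTop 1 tendsto_id)).sub hr
  have hK := hshift.sub hdiff
  simp only [Function.comp_def, id, sub_sub_cancel, sub_zero] at hK
  exact tendsto_nhds_unique tendsto_const_nhds hK

/-- The Wronskian `f' g - f g'`. -/
noncomputable def wronskian (f g : ℝ → ℂ) (x : ℝ) : ℂ :=
  deriv f x * g x - f x * deriv g x

section Wronskian

variable {f g : ℝ → ℂ}

theorem exists_eq_mul_of_wronskian_eq_zero (hf : AnalyticOnNhd ℝ f (Ioi 0))
    (hg : AnalyticOnNhd ℝ g (Ioi 0)) (hW : ∀ x : ℝ, 0 < x → wronskian f g x = 0)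
    {x₀ : ℝ} (hx₀ : 0 < x₀) (h0 : g x₀ ≠ 0) :
    ∃ k : ℂ, ∀ x : ℝ, 0 < x → f x = k * g x := by
  refine ⟨f x₀ / g x₀, ?_⟩
  have hne : ∀ᶠ x in 𝓝 x₀, g x ≠ 0 := (hg x₀ hx₀).continuousAt.eventually_ne h0
  obtain ⟨ε, hε, hball⟩ := Metric.eventually_nhds_iff_ball.1 (hne.and (lt_mem_nhds hx₀))
  have hquot : ∀ x ∈ Metric.ball x₀ ε, HasDerivAt (fun x => f x / g x) 0 x := fun x hx => by
    obtain ⟨hgx, hx0⟩ := hball x hx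
    refine ((hf x hx0).differentiableAt.hasDerivAt.div (hg x hx0).differentiableAt.hasDerivAt
      hgx).congr_deriv ?_
    rw [show deriv f x * g x - f x * deriv g x = 0 from hW x hx0, zero_div]
  have hev : f =ᶠ[𝓝 x₀] fun x => f x₀ / g x₀ * g x := by
    filter_upwards [Metric.ball_mem_nhds x₀ hε] with x hx
    rw [← Metric.isOpen_ball.is_const_of_deriv_eq_zero (convex_ball x₀ ε).isPreconnected
      (fun y hy => (hquot y hy).differentiableAt.differentiableWithinAt)
      (fun y hy => (hquot y hy).deriv) hx (Metric.mem_ball_self hε),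
      div_mul_cancel₀ _ (hball x hx).1]
  exact fun x hx => hf.eqOn_of_preconnected_of_eventuallyEq (analyticOnNhd_const.mul hg)
    isPreconnected_Ioi hx₀ hev hx

theorem hasDerivAt_wronskian {p q : ℂ} {x : ℝ} (hf : AnalyticAt ℝ f x) (hg : AnalyticAt ℝ g x)
    (hf'' : deriv (deriv f) x = p * deriv f x + q * f x)
    (hg'' : deriv (deriv g) x = p * deriv g x + q * g x) :
    HasDerivAt (wronskian f g) (p * wronskian f g x) x := by
  refine ((hf.deriv.differentiableAt.hasDerivAt.mul hg.differentiableAt.hasDerivAt).sub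
    (hf.differentiableAt.hasDerivAt.mul hg.deriv.differentiableAt.hasDerivAt)).congr_deriv ?_
  rw [hf'', hg'', wronskian]
  ring

variable {c b : ℂ} {q : ℝ → ℂ} (hf : AnalyticOnNhd ℝ f (Ioi 0)) (hg : AnalyticOnNhd ℝ g (Ioi 0))
  (hf'' : ∀ x : ℝ, 0 < x → deriv (deriv f) x = -(c * (x : ℂ)⁻¹ - b) * deriv f x + q x * f x)
  (hg'' : ∀ x : ℝ, 0 < x → deriv (deriv g) x = -(c * (x : ℂ)⁻¹ - b) * deriv g x + q x * g x)

include hf hg hf'' hg''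

theorem cpowExp_mul_wronskian_eq {x y : ℝ} (hx : 0 < x) (hy : 0 < y) :
    cpowExp c b x * wronskian f g x = cpowExp c b y * wronskian f g y := by
  have hderiv : ∀ z ∈ Ioi (0 : ℝ),
      HasDerivAt (fun z => cpowExp c b z * wronskian f g z) 0 z := fun z hz =>
    ((hasDerivAt_cpowExp c b hz).mul (hasDerivAt_wronskian (hf z hz) (hg z hz) (hf'' z hz)
      (hg'' z hz))).congr_deriv (by ring)
  exact isOpen_Ioi.is_const_of_deriv_eq_zero isPreconnected_Ioi
    (fun z hz => (hderiv z hz).differentiableAt.differentiableWithinAt)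
    (fun z hz => (hderiv z hz).deriv) hx hy

/-- The weight times `f g` tends to zero, while its derivative tends to the constant value of the
weight times the Wronskian. -/
theorem wronskian_eq_zero_of_hasPolyGrowth (hb : 0 < b.re) (pf : HasPolyGrowth f)
    (pg : HasPolyGrowth g) (pg' : HasPolyGrowth (deriv g)) {x : ℝ} (hx : 0 < x) :
    wronskian f g x = 0 := by
  set K := cpowExp c b x * wronskian f g x with hK
  have hderiv : ∀ y : ℝ, 0 < y → HasDerivAt (fun y => cpowExp c b y * (f y * g y))
      (K + cpowExp c b y * ((c * (y : ℂ)⁻¹ + -b) * (f y * g y) + 2 * (f y * deriv g y))) y := by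
    intro y hy
    refine ((hasDerivAt_cpowExp c b hy).mul ((hf y hy).differentiableAt.hasDerivAt.mul
      (hg y hy).differentiableAt.hasDerivAt)).congr_deriv ?_
    rw [hK, cpowExp_mul_wronskian_eq hf hg hf'' hg'' hx hy, wronskian]
    simp only [Pi.mul_apply]
    ring
  have hgrowth : HasPolyGrowth fun y =>
      (c * (y : ℂ)⁻¹ + -b) * (f y * g y) + 2 * (f y * deriv g y) :=
    ((((hasPolyGrowth_const c).mul hasPolyGrowth_inv).add (hasPolyGrowth_const (-b))).mul
      (pf.mul pg)).add ((hasPolyGrowth_const 2).mul (pf.mul pg'))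
  have hK0 : K = 0 := eq_zero_of_tendsto_deriv (tendsto_cpowExp_mul c hb (pf.mul pg)) hderiv
    (by simpa using (tendsto_const_nhds (x := K)).add (tendsto_cpowExp_mul c hb hgrowth))
  exact (mul_eq_zero.1 hK0).resolve_left (cpowExp_ne_zero c b hx)

end Wronskian

/-! ### Existence and uniqueness of Tricomi's function -/

theorem isBigO_cpow_of_normalized {a : ℂ} {f : ℝ → ℂ}
    (h : (fun x : ℝ => f x - (x : ℂ) ^ (-a)) =O[atTop] fun x : ℝ => (x : ℂ) ^ (-a - 1)) :
    f =O[atTop] fun x : ℝ => (x : ℂ) ^ (-a) := by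
  simpa using (h.trans (isBigO_cpow_of_re_le (b := -a) (by simp))).add
    (isBigO_refl (fun x : ℝ => (x : ℂ) ^ (-a)) atTop)

theorem isTricomiPsi_of_hasDerivAt {a c : ℂ} {f f' f'' : ℝ → ℂ} (hf : AnalyticOnNhd ℝ f (Ioi 0))
    (hf' : ∀ x : ℝ, 0 < x → HasDerivAt f (f' x) x)
    (hf'' : ∀ x : ℝ, 0 < x → HasDerivAt f' (f'' x) x)
    (hode : ∀ x : ℝ, 0 < x → (x : ℂ) * f'' x + (c - x) * f' x - a * f x = 0)
    (h : (fun x : ℝ => f x - (x : ℂ) ^ (-a)) =O[atTop] fun x : ℝ => (x : ℂ) ^ (-a - 1)) :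
    IsTricomiPsi a c f where
  analytic := hf
  ode x hx := by
    have hev : deriv f =ᶠ[𝓝 x] f' := by
      filter_upwards [lt_mem_nhds hx] with y hy using (hf' y hy).deriv
    rw [iteratedDeriv_succ, iteratedDeriv_one, hev.deriv_eq, (hf'' x hx).deriv, (hf' x hx).deriv]
    exact hode x hx
  growth := HasPolyGrowth.of_isBigO_cpow (isBigO_cpow_of_normalized h)
  normalized := h

theorem eq_zero_of_mul_cpow_isBigO {a k : ℂ}
    (h : (fun x : ℝ => k * (x : ℂ) ^ (-a)) =O[atTop] fun x : ℝ => (x : ℂ) ^ (-a - 1)) :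
    k = 0 := by
  have hk : (fun _ : ℝ => k) =O[atTop] fun x : ℝ => x⁻¹ := by
    refine (((isBigO_refl (fun x : ℝ => (x : ℂ) ^ a) atTop).mul h).congr' ?_ EventuallyEq.rfl).trans
      (IsBigO.of_bound' ?_)
    all_goals filter_upwards [eventually_gt_atTop 0] with x hx
    · rw [mul_left_comm, ← Complex.cpow_add _ _ (Complex.ofReal_ne_zero.2 hx.ne'), add_neg_cancel,
        Complex.cpow_zero, mul_one]
    · rw [← Complex.cpow_add _ _ (Complex.ofReal_ne_zero.2 hx.ne'), add_sub_assoc',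
        add_neg_cancel, zero_sub, Complex.cpow_neg_one, norm_inv, norm_inv, Complex.norm_real]
  exact tendsto_nhds_unique tendsto_const_nhds (hk.trans_tendsto tendsto_inv_atTop_zero)

theorem rpow_isBigO_cpow_sub_one (a : ℂ) :
    (fun x : ℝ => x ^ (-(a.re + 1))) =O[atTop] fun x : ℝ => (x : ℂ) ^ (-a - 1) := by
  have h := isBigO_cpow_rpow (-a - 1)
  rwa [Complex.sub_re, Complex.neg_re, Complex.one_re, ← neg_add'] at h

theorem laplace_tricomiDensity_sub_isBigO {a : ℂ} (b : ℂ) (ha : 0 < a.re) :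
    (fun x : ℝ => laplace (tricomiDensity a b) x - Complex.Gamma a * (x : ℂ) ^ (-a)) =O[atTop]
      fun x : ℝ => (x : ℂ) ^ (-a - 1) := by
  have hs := hasLaplaceBound_tricomiDensity_sub a b
  have ha1 : 0 < a.re + 1 := by linarith
  refine ((hs.laplace_isBigO ha1).trans (rpow_isBigO_cpow_sub_one a)).congr' ?_ EventuallyEq.rfl
  filter_upwards [eventually_gt_atTop 0] with x hx
  have hxr : 0 < (x : ℂ).re := by rwa [Complex.ofReal_re]
  have hpow := (hasLaplaceBound_tricomiDensity a 0).integrableOn ha hxr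
  simp only [tricomiDensity, Complex.cpow_zero, mul_one] at hpow
  rw [← laplace_cpow ha hx, laplace, laplace, laplace, ← integral_sub
    ((hasLaplaceBound_tricomiDensity a b).integrableOn ha hxr) hpow]
  simp only [mul_sub]

section Laplace

variable {a : ℂ} (c : ℂ) (ha : 0 < a.re)

include ha

theorem hasDerivAt_laplace_tricomiDensity {x : ℝ} (hx : 0 < x) :
    HasDerivAt (fun x : ℝ => (Complex.Gamma a)⁻¹ * laplace (tricomiDensity a (c - a - 1)) x)
      ((Complex.Gamma a)⁻¹ * -laplace (fun t => t * tricomiDensity a (c - a - 1) t) x) x :=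
  ((hasLaplaceBound_tricomiDensity a _).hasDerivAt_laplace_ofReal ha hx).const_mul _

theorem isTricomiPsi_laplace :
    IsTricomiPsi a c fun x => (Complex.Gamma a)⁻¹ * laplace (tricomiDensity a (c - a - 1)) x := by
  have hp := hasLaplaceBound_tricomiDensity a (c - a - 1)
  have ha1 : 0 < a.re + 1 := by linarith
  refine isTricomiPsi_of_hasDerivAt (analyticOnNhd_const.mul (hp.analyticOnNhd_laplace ha))
    (fun x hx => hasDerivAt_laplace_tricomiDensity c ha hx)
    (fun x hx => ((hp.mul_id.hasDerivAt_laplace_ofReal ha1 hx).fun_neg).const_mul _)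
    (fun x hx => ?_) ?_
  · linear_combination (Complex.Gamma a)⁻¹ * laplace_tricomiDensity_ode c ha hx
  · refine ((laplace_tricomiDensity_sub_isBigO (c - a - 1) ha).const_mul_left
      (Complex.Gamma a)⁻¹).congr_left fun x => ?_
    rw [mul_sub, inv_mul_cancel_left₀ (Complex.Gamma_ne_zero_of_re_pos ha)]

theorem deriv_laplace_tricomiDensity_isBigO :
    deriv (fun x : ℝ => (Complex.Gamma a)⁻¹ * laplace (tricomiDensity a (c - a - 1)) x)
      =O[atTop] fun x : ℝ => (x : ℂ) ^ (-a - 1) := by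
  have ha1 : 0 < a.re + 1 := by linarith
  refine ((((hasLaplaceBound_tricomiDensity a (c - a - 1)).mul_id.laplace_isBigO ha1).trans
    (rpow_isBigO_cpow_sub_one a)).neg_left.const_mul_left (Complex.Gamma a)⁻¹).congr' ?_
      EventuallyEq.rfl
  filter_upwards [eventually_gt_atTop 0] with x hx
  exact (hasDerivAt_laplace_tricomiDensity c ha hx).deriv.symm

end Laplace

namespace IsTricomiPsi

variable {a c : ℂ} {f g : ℝ → ℂ}

theorem isBigO (h : IsTricomiPsi a c f) : f =O[atTop] fun x : ℝ => (x : ℂ) ^ (-a) :=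
  isBigO_cpow_of_normalized h.normalized

theorem deriv_deriv_eq (h : IsTricomiPsi a c f) {x : ℝ} (hx : 0 < x) :
    deriv (deriv f) x = -(c * (x : ℂ)⁻¹ - 1) * deriv f x + a * (x : ℂ)⁻¹ * f x := by
  have hx' : (x : ℂ) ≠ 0 := Complex.ofReal_ne_zero.2 hx.ne'
  have hode := h.ode x hx
  rw [iteratedDeriv_succ, iteratedDeriv_one] at hode
  field_simp
  linear_combination hode

theorem exists_ne_zero (h : IsTricomiPsi a c f) : ∃ x : ℝ, 0 < x ∧ f x ≠ 0 := by
  by_contra! hzero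
  refine one_ne_zero (eq_zero_of_mul_cpow_isBigO (a := a) (k := 1) ?_)
  refine h.normalized.neg_left.congr' ?_ EventuallyEq.rfl
  filter_upwards [eventually_gt_atTop 0] with x hx
  rw [hzero x hx]
  ring

theorem eqOn_of_deriv_isBigO (hf : IsTricomiPsi a c f) (hg : IsTricomiPsi a c g)
    (hg' : deriv g =O[atTop] fun x : ℝ => (x : ℂ) ^ (-a - 1)) : EqOn f g (Ioi 0) := by
  obtain ⟨x₀, hx₀, h0⟩ := hg.exists_ne_zero
  obtain ⟨k, hk⟩ := exists_eq_mul_of_wronskian_eq_zero hf.analytic hg.analytic (fun x hx =>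
    wronskian_eq_zero_of_hasPolyGrowth hf.analytic hg.analytic (fun _ => hf.deriv_deriv_eq)
      (fun _ => hg.deriv_deriv_eq) (by simp) hf.growth hg.growth (.of_isBigO_cpow hg') hx) hx₀ h0
  have hk1 : k - 1 = 0 := by
    refine eq_zero_of_mul_cpow_isBigO (a := a)
      ((hf.normalized.sub (hg.normalized.const_mul_left k)).congr' ?_ EventuallyEq.rfl)
    filter_upwards [eventually_gt_atTop 0] with x hx
    rw [hk x hx]
    ring
  intro x hx
  rw [hk x hx, sub_eq_zero.1 hk1, one_mul]

end IsTricomiPsi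

/-- The operator `(x + 1 - c) - x ∂ₓ` of the contiguous relation that carries `Ψ(a, c; x)` to
`Ψ(a - 1, c - 1; x)`. -/
noncomputable def tricomiLower (c : ℂ) (f : ℝ → ℂ) (x : ℝ) : ℂ :=
  (x + 1 - c) * f x - x * deriv f x

namespace IsTricomiPsi

variable {a c : ℂ} {f : ℝ → ℂ}

theorem hasDerivAt_tricomiLower (h : IsTricomiPsi a c f) {x : ℝ} (hx : 0 < x) :
    HasDerivAt (tricomiLower c f) ((1 - a) * f x) x := by
  have hode := h.ode x hx
  rw [iteratedDeriv_succ, iteratedDeriv_one] at hode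
  refine (((((hasDerivAt_ofReal x).add_const 1).sub_const c).mul
    (h.analytic x hx).differentiableAt.hasDerivAt).sub ((hasDerivAt_ofReal x).mul
      (h.analytic.deriv x hx).differentiableAt.hasDerivAt)).congr_deriv ?_
  linear_combination -hode

theorem deriv_tricomiLower_isBigO (h : IsTricomiPsi a c f) :
    deriv (tricomiLower c f) =O[atTop] fun x : ℝ => (x : ℂ) ^ (-(a - 1) - 1) := by
  rw [neg_sub, sub_sub_cancel_left]
  refine (h.isBigO.const_mul_left (1 - a)).congr' ?_ EventuallyEq.rfl
  filter_upwards [eventually_gt_atTop 0] with x hx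
  exact (h.hasDerivAt_tricomiLower hx).deriv.symm

theorem tricomiLower (h : IsTricomiPsi a c f)
    (hd : deriv f =O[atTop] fun x : ℝ => (x : ℂ) ^ (-a - 1)) :
    IsTricomiPsi (a - 1) (c - 1) (tricomiLower c f) := by
  have hid := analyticOnNhd_ofReal (Ioi 0)
  refine isTricomiPsi_of_hasDerivAt
    ((((hid.add analyticOnNhd_const).sub analyticOnNhd_const).mul h.analytic).sub
      (hid.mul h.analytic.deriv)) (fun x hx => h.hasDerivAt_tricomiLower hx)
    (fun x hx => (h.analytic x hx).differentiableAt.hasDerivAt.const_mul (1 - a))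
    (fun x _ => by rw [_root_.tricomiLower]; ring) ?_
  have hmul {g : ℝ → ℂ} (hg : g =O[atTop] fun x : ℝ => (x : ℂ) ^ (-a - 1)) :
      (fun x : ℝ => (x : ℂ) * g x) =O[atTop] fun x : ℝ => (x : ℂ) ^ (-a) := by
    refine ((isBigO_refl (fun x : ℝ => (x : ℂ)) atTop).mul hg).congr' EventuallyEq.rfl ?_
    filter_upwards [eventually_gt_atTop 0] with x hx
    rw [ofReal_mul_cpow _ hx, sub_add_cancel]
  rw [neg_sub, sub_sub_cancel_left]
  refine (((hmul h.normalized).add (h.isBigO.const_mul_left (1 - c))).sub (hmul hd)).congr' ?_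
    EventuallyEq.rfl
  filter_upwards [eventually_gt_atTop 0] with x hx
  rw [_root_.tricomiLower, sub_eq_neg_add 1 a, ← ofReal_mul_cpow (-a) hx]
  ring

end IsTricomiPsi

theorem exists_isTricomiPsi_deriv_isBigO (a c : ℂ) : ∃ f, IsTricomiPsi a c f ∧
    deriv f =O[atTop] fun x : ℝ => (x : ℂ) ^ (-a - 1) := by
  obtain ⟨n, hn⟩ := exists_nat_gt (-a.re)
  induction n generalizing a c with
  | zero =>
    have ha : 0 < a.re := by simpa using hn
    exact ⟨_, isTricomiPsi_laplace c ha, deriv_laplace_tricomiDensity_isBigO c ha⟩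
  | succ n ih =>
    obtain ⟨f, hf, hd⟩ := ih (a + 1) (c + 1) (by
      rw [Complex.add_re, Complex.one_re]
      push_cast at hn
      linarith)
    have hlower := hf.tricomiLower hd
    have hderiv := hf.deriv_tricomiLower_isBigO
    rw [add_sub_cancel_right] at hlower hderiv
    rw [add_sub_cancel_right] at hlower
    exact ⟨_, hlower, hderiv⟩

theorem isTricomiPsi_tricomiPsi (a c : ℂ) : IsTricomiPsi a c (tricomiPsi a c) := by
  have h : ∃ f, IsTricomiPsi a c f := (exists_isTricomiPsi_deriv_isBigO a c).imp fun _ => And.left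
  have heq : tricomiPsi a c = h.choose := funext fun x => dif_pos h
  exact heq ▸ h.choose_spec

namespace IsTricomiPsi

variable {a c : ℂ} {f g : ℝ → ℂ}

theorem eqOn (hf : IsTricomiPsi a c f) (hg : IsTricomiPsi a c g) : EqOn f g (Ioi 0) := by
  obtain ⟨p, hp, hp'⟩ := exists_isTricomiPsi_deriv_isBigO a c
  exact (hf.eqOn_of_deriv_isBigO hp hp').trans (hg.eqOn_of_deriv_isBigO hp hp').symm

theorem deriv_isBigO (hf : IsTricomiPsi a c f) :
    deriv f =O[atTop] fun x : ℝ => (x : ℂ) ^ (-a - 1) := by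
  obtain ⟨p, hp, hp'⟩ := exists_isTricomiPsi_deriv_isBigO a c
  refine hp'.congr' ?_ EventuallyEq.rfl
  filter_upwards [eventually_gt_atTop 0] with x hx
  exact ((hp.eqOn hf).eventuallyEq_of_mem (Ioi_mem_nhds hx)).deriv_eq

end IsTricomiPsi

end Tricomi

section ReflectionEquation

/-! ### The reflection equation in components -/

section Legs

variable {𝒜 : Type*} [Ring 𝒜] (M : Matrix (Fin 2) (Fin 2) 𝒜)

theorem firstLeg_apply (i k j l : Fin 2) :
    firstLeg M (i, k) (j, l) = if k = l then M i j else 0 := by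
  simp only [firstLeg, Matrix.kroneckerMap_apply, Matrix.one_apply, mul_ite, mul_one, mul_zero]

theorem secondLeg_apply (i k j l : Fin 2) :
    secondLeg M (i, k) (j, l) = if i = j then M k l else 0 := by
  simp only [secondLeg, Matrix.kroneckerMap_apply, Matrix.one_apply, ite_mul, one_mul, zero_mul]

variable (X : Matrix (Fin 2 × Fin 2) (Fin 2 × Fin 2) 𝒜)

theorem firstLeg_mul_apply (i k : Fin 2) (q : Fin 2 × Fin 2) :
    (firstLeg M * X) (i, k) q = ∑ s, M i s * X (s, k) q := by
  simp only [Matrix.mul_apply, Fintype.sum_prod_type, firstLeg_apply, ite_mul, zero_mul,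
    Finset.sum_ite_eq, Finset.mem_univ, if_true]

theorem secondLeg_mul_apply (i k : Fin 2) (q : Fin 2 × Fin 2) :
    (secondLeg M * X) (i, k) q = ∑ s, M k s * X (i, s) q := by
  simp only [Matrix.mul_apply, Fintype.sum_prod_type_right, secondLeg_apply, ite_mul, zero_mul,
    Finset.sum_ite_eq, Finset.mem_univ, if_true]

end Legs

variable {𝒜 ℬ : Type*} [Ring 𝒜] [Algebra ℂ 𝒜] [Ring ℬ] [Algebra ℂ ℬ]

theorem rMatrix_mul_apply (u : ℂ) (X : Matrix (Fin 2 × Fin 2) (Fin 2 × Fin 2) 𝒜) (i k : Fin 2)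
    (q : Fin 2 × Fin 2) : (rMatrix 𝒜 u * X) (i, k) q = u • X (i, k) q + X (k, i) q := by
  have hflip (p : Fin 2 × Fin 2) : i = p.2 ∧ k = p.1 ↔ (k, i) = p := by
    rw [Prod.ext_iff, and_comm]
  rw [rMatrix, add_mul, smul_mul_assoc, one_mul, Matrix.add_apply, Matrix.smul_apply,
    Matrix.mul_apply]
  simp only [Matrix.of_apply, ite_mul, one_mul, zero_mul, hflip, Finset.sum_ite_eq,
    Finset.mem_univ, if_true]

theorem mul_rMatrix_apply (u : ℂ) (X : Matrix (Fin 2 × Fin 2) (Fin 2 × Fin 2) 𝒜)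
    (p : Fin 2 × Fin 2) (j l : Fin 2) :
    (X * rMatrix 𝒜 u) p (j, l) = u • X p (j, l) + X p (l, j) := by
  have hflip (q : Fin 2 × Fin 2) : q.1 = l ∧ q.2 = j ↔ q = (l, j) := by rw [Prod.ext_iff]
  rw [rMatrix, mul_add, mul_smul_comm, mul_one, Matrix.add_apply, Matrix.smul_apply,
    Matrix.mul_apply]
  simp only [Matrix.of_apply, mul_ite, mul_one, mul_zero, hflip, Finset.sum_ite_eq',
    Finset.mem_univ, if_true]

section Components

variable (u v : ℂ) (M N : Matrix (Fin 2) (Fin 2) 𝒜) (i k j l : Fin 2)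

theorem reflectionLeft_apply : reflectionLeft u v M N (i, k) (j, l) =
    (u - v) • ((u + v - 1) • (M i j * N k l) + if k = j then (M * N) i l else 0) +
      ((u + v - 1) • (M k j * N i l) + if i = j then (M * N) k l else 0) := by
  simp only [reflectionLeft, mul_assoc, rMatrix_mul_apply, firstLeg_mul_apply, secondLeg_apply,
    mul_add, mul_smul_comm, mul_ite, mul_zero, smul_ite, smul_zero, Finset.sum_add_distrib,
    Finset.sum_ite_eq', Finset.mem_univ, if_true]
  simp only [Matrix.mul_apply, Finset.sum_ite_irrel, Finset.sum_const_zero]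

theorem reflectionRight_apply : reflectionRight u v M N (i, k) (j, l) =
    (u - v) • ((u + v - 1) • (N k l * M i j) + if i = l then (N * M) k j else 0) +
      ((u + v - 1) • (N k j * M i l) + if i = j then (N * M) k l else 0) := by
  simp only [reflectionRight, mul_rMatrix_apply]
  simp only [mul_assoc, rMatrix_mul_apply, secondLeg_mul_apply, firstLeg_apply,
    mul_add, mul_smul_comm, mul_ite, mul_zero, smul_ite, smul_zero, Finset.sum_add_distrib,
    Finset.sum_ite_eq', Finset.mem_univ, if_true]
  simp only [Matrix.mul_apply, Finset.sum_ite_irrel, Finset.sum_const_zero]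

end Components

section Map

variable (g : 𝒜 →ₐ[ℂ] ℬ)

theorem rMatrix_map (z : ℂ) : (rMatrix 𝒜 z).map g = rMatrix ℬ z := by
  ext p q : 1
  simp only [rMatrix, Matrix.map_apply, Matrix.add_apply, Matrix.smul_apply, Matrix.of_apply,
    Matrix.one_apply, map_add, map_smul, apply_ite g, map_one, map_zero]

theorem firstLeg_map (M : Matrix (Fin 2) (Fin 2) 𝒜) :
    (firstLeg M).map g = firstLeg (M.map g) := by
  ext ⟨i, k⟩ ⟨j, l⟩ : 1
  simp only [Matrix.map_apply, firstLeg_apply, apply_ite g, map_zero]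

theorem secondLeg_map (M : Matrix (Fin 2) (Fin 2) 𝒜) :
    (secondLeg M).map g = secondLeg (M.map g) := by
  ext ⟨i, k⟩ ⟨j, l⟩ : 1
  simp only [Matrix.map_apply, secondLeg_apply, apply_ite g, map_zero]

theorem reflectionLeft_map (u v : ℂ) (M N : Matrix (Fin 2) (Fin 2) 𝒜) :
    (reflectionLeft u v M N).map g = reflectionLeft u v (M.map g) (N.map g) := by
  simp only [reflectionLeft, Matrix.map_mul, rMatrix_map, firstLeg_map, secondLeg_map]

theorem reflectionRight_map (u v : ℂ) (M N : Matrix (Fin 2) (Fin 2) 𝒜) :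
    (reflectionRight u v M N).map g = reflectionRight u v (M.map g) (N.map g) := by
  simp only [reflectionRight, Matrix.map_mul, rMatrix_map, firstLeg_map, secondLeg_map]

end Map

theorem isQISMRep_of_relations {S : Set ℂ} {W : Type*} [AddCommGroup W] [Module ℂ W]
    {U : ℂ → Matrix (Fin 2) (Fin 2) (Module.End ℂ W)}
    (hrefl : ∀ u ∈ S, ∀ v ∈ S, reflectionLeft u v (U u) (U v) = reflectionRight u v (U u) (U v))
    (hA : ∀ u ∈ S, -u ∈ S → 2 * u + 1 ≠ 0 →
      -U (-u) 0 0 = U u 1 1 - (2 * u + 1)⁻¹ • (U u 0 0 + U u 1 1))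
    (hD : ∀ u ∈ S, -u ∈ S → 2 * u + 1 ≠ 0 →
      -U (-u) 1 1 = U u 0 0 - (2 * u + 1)⁻¹ • (U u 0 0 + U u 1 1))
    (hB : ∀ u ∈ S, -u ∈ S → U (-u) 0 1 = U u 0 1)
    (hC : ∀ u ∈ S, -u ∈ S → U (-u) 1 0 = U u 1 0) : IsQISMRep S U := by
  let g : FreeQISM S →ₐ[ℂ] Module.End ℂ W := FreeAlgebra.lift ℂ fun t => U t.1 t.2.1 t.2.2
  have hg (u : S) (i j : Fin 2) : g (freeU S u i j) = U u i j := FreeAlgebra.lift_ι_apply _ _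
  have hmap (u : S) : (freeU S u).map g = U u := Matrix.ext (hg u)
  have hrel : ∀ ⦃x y⦄, QISMRel S x y → g x = g y := by
    intro x y hxy
    induction hxy with
    | reflection u v p q =>
      have h := hrefl u u.2 v v.2
      rw [← hmap u, ← hmap v, ← reflectionLeft_map, ← reflectionRight_map] at h
      exact congrFun (congrFun h p) q
    | symmA u v hv hu =>
      simpa only [map_neg, map_sub, map_smul, map_add, hg, hv] using hA u u.2 (hv ▸ v.2) hu
    | symmD u v hv hu =>
      simpa only [map_neg, map_sub, map_smul, map_add, hg, hv] using hD u u.2 (hv ▸ v.2) hu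
    | symmB u v hv => simpa only [hg, hv] using hB u u.2 (hv ▸ v.2)
    | symmC u v hv => simpa only [hg, hv] using hC u u.2 (hv ▸ v.2)
  refine ⟨RingQuot.liftAlgHom ℂ ⟨g, hrel⟩, fun u i j => ?_⟩
  rw [qismGen, Matrix.map_apply, RingQuot.liftAlgHom_mkAlgHom_apply, hg]

end ReflectionEquation

section ShiftAlgebra

/-! ### The algebra generated by `x⁻¹`, `∂ₓ` and `C(0)` -/

/-- The relations between `Y = x⁻¹`, `D = ∂ₓ` and `C = C(0)`. They allow every polynomial in these
operators to be normally ordered, which is how identities between such polynomials are checked. -/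
structure IsShiftTriple {𝒜 : Type*} [Ring 𝒜] [Algebra ℂ 𝒜] (δ : ℂ) (Y D C : 𝒜) : Prop where
  d_mul_y : D * Y = Y * D - Y * Y
  c_mul_y : C * Y = Y * C + (2 : ℂ) • D - Y
  c_mul_d : C * D = D * C - (2 : ℂ) • (Y * C) - D + (2 * δ) • (1 : 𝒜)
  d_mul_d : D * D = -(Y * (Y * C)) - Y * D + (1 / 4 : ℂ) • (1 : 𝒜) + (2 * δ) • Y

/-- The `L`-operator as a matrix over the algebra generated by `Y = x⁻¹`, `D = ∂ₓ` and `C = C(0)`,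
where `κ` stands for `δ / (u - ½)`. -/
def shiftMatrix {𝒜 : Type*} [Ring 𝒜] [Algebra ℂ 𝒜] (Y D C : 𝒜) (u κ : ℂ) :
    Matrix (Fin 2) (Fin 2) 𝒜 :=
  !![u • Y + D + κ • 1, Y ^ 2; C + u ^ 2 • 1, (u + 1) • Y - D + κ • 1]

variable {𝒜 : Type*} [Ring 𝒜] [Algebra ℂ 𝒜] {δ : ℂ} {Y D C : 𝒜}

theorem isShiftTriple_of_mul_eq {X : 𝒜ˣ} (h : D * X = X * D + 1) (δ : ℂ) :
    IsShiftTriple δ (↑X⁻¹ : 𝒜) D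
      (-((X : 𝒜) ^ 2 * D ^ 2) - X * D + (1 / 4 : ℂ) • (X : 𝒜) ^ 2 + (2 * δ) • (X : 𝒜)) := by
  have d_mul_x (z : 𝒜) : D * (X * z) = X * (D * z) + z := by
    rw [← mul_assoc, h, add_mul, one_mul, mul_assoc]
  have d_mul_y : D * ↑X⁻¹ = ↑X⁻¹ * D - ↑X⁻¹ * (↑X⁻¹ : 𝒜) := by
    rw [eq_sub_iff_add_eq, Units.eq_inv_mul_iff_mul_eq, mul_add, Units.mul_inv_cancel_left,
      ← mul_assoc, ← sub_eq_iff_eq_add.2 h, sub_mul, one_mul, mul_assoc, Units.mul_inv, mul_one,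
      sub_add_cancel]
  have d_mul_y_mul (z : 𝒜) : D * (↑X⁻¹ * z) = ↑X⁻¹ * (D * z) - ↑X⁻¹ * (↑X⁻¹ * z) := by
    rw [← mul_assoc, d_mul_y, sub_mul, mul_assoc, mul_assoc]
  constructor
  · exact d_mul_y
  all_goals
    simp only [pow_two, add_mul, mul_add, sub_mul, mul_sub, neg_mul, mul_neg, smul_mul_assoc,
      mul_smul_comm, mul_assoc, h, d_mul_x, d_mul_y, d_mul_y_mul, Units.mul_inv_cancel_left,
      Units.inv_mul_cancel_left, Units.mul_inv, Units.inv_mul, mul_one]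
    module

namespace IsShiftTriple

variable (h : IsShiftTriple δ Y D C)
include h

theorem d_mul_y_mul (z : 𝒜) : D * (Y * z) = Y * (D * z) - Y * (Y * z) := by
  rw [← mul_assoc, h.d_mul_y, sub_mul, mul_assoc, mul_assoc]

theorem c_mul_y_mul (z : 𝒜) : C * (Y * z) = Y * (C * z) + (2 : ℂ) • (D * z) - Y * z := by
  rw [← mul_assoc, h.c_mul_y, sub_mul, add_mul, mul_assoc, smul_mul_assoc]

theorem factorization {u κ : ℂ} (hu : κ * (u - 1 / 2) = δ) :
    ((u - 1) • Y - D + κ • 1) * (u • Y + D + κ • 1) =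
      Y * (Y * (C + u ^ 2 • 1)) + (κ ^ 2 - 1 / 4) • 1 := by
  simp only [add_mul, mul_add, sub_mul, smul_mul_assoc, mul_smul_comm, mul_one, one_mul,
    h.d_mul_y, h.d_mul_d]
  match_scalars <;> grind

theorem reflectionLeft_eq_reflectionRight {u v κ η : ℂ} (hu : κ * (u - 1 / 2) = δ)
    (hv : η * (v - 1 / 2) = δ) :
    reflectionLeft u v (shiftMatrix Y D C u κ) (shiftMatrix Y D C v η) =
      reflectionRight u v (shiftMatrix Y D C u κ) (shiftMatrix Y D C v η) := by
  ext ⟨i, k⟩ ⟨j, l⟩ : 1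
  rw [reflectionLeft_apply, reflectionRight_apply]
  fin_cases i <;> fin_cases k <;> fin_cases j <;> fin_cases l <;>
  simp only [shiftMatrix, Matrix.mul_apply, Fin.sum_univ_two, Fin.zero_eta, Fin.mk_one,
    Fin.isValue, one_ne_zero, zero_ne_one, if_true, if_false, add_zero, Matrix.of_apply,
    Matrix.cons_val', Matrix.cons_val_zero, Matrix.cons_val_one, Matrix.cons_val_fin_one, pow_two,
    add_mul, mul_add, sub_mul, mul_sub, smul_mul_assoc, mul_smul_comm, mul_assoc, mul_one, one_mul,
    h.d_mul_y_mul, h.c_mul_y_mul, h.d_mul_y, h.c_mul_y, h.c_mul_d, h.d_mul_d] <;>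
  match_scalars <;> grind

end IsShiftTriple

end ShiftAlgebra

section Operators

open Set

/-! ### The representation on `W` -/

theorem rapidSpace_ext {f g : rapidSpace} (h : EqOn f.1 g.1 (Ioi 0)) : f = g := by
  refine Subtype.ext (funext fun x => ?_)
  rcases le_or_gt x 0 with hx | hx
  · rw [IsRapid.zero f.2 x hx, IsRapid.zero g.2 x hx]
  · exact h hx

/-- Multiplication by `x` as an invertible operator on `W`, with inverse `opXinv`. -/
noncomputable def opXUnit : (Module.End ℂ rapidSpace)ˣ where
  val := opX
  inv := opXinv
  val_inv := LinearMap.ext fun _ => rapidSpace_ext fun _ hx =>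
    mul_inv_cancel_left₀ (Complex.ofReal_ne_zero.2 (ne_of_gt hx)) _
  inv_val := LinearMap.ext fun _ => rapidSpace_ext fun _ hx =>
    inv_mul_cancel_left₀ (Complex.ofReal_ne_zero.2 (ne_of_gt hx)) _

theorem opD_mul_opX : opD * opX = opX * opD + 1 := by
  refine LinearMap.ext fun f => rapidSpace_ext fun x hx => ?_
  have hf := (IsRapid.analytic f.2 x hx).differentiableAt.hasDerivAt
  refine ((hasDerivAt_ofReal x).mul hf).deriv.trans ?_
  change _ = (x : ℂ) * deriv f.1 x + f.1 x
  ring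

variable (δ u : ℂ)

theorem isShiftTriple_op : IsShiftTriple δ opXinv opD (opC δ 0) := by
  have hC : opC δ 0 =
      -(opX ^ 2 * opD ^ 2) - opX * opD + (1 / 4 : ℂ) • opX ^ 2 + (2 * δ) • opX := by
    rw [opC, zero_pow two_ne_zero, zero_smul, add_zero]
  rw [hC]
  exact isShiftTriple_of_mul_eq (X := opXUnit) (D := opD) opD_mul_opX δ

theorem opA_eq : opA δ u = u • opXinv + opD + (δ / (u - 1 / 2)) • 1 := by
  rw [opA, opA1, opA0]
  module

theorem opDD_eq : opDD δ u = (u + 1) • opXinv - opD + (δ / (u - 1 / 2)) • 1 := by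
  rw [opDD, opA1, opA0]
  module

theorem opC_eq : opC δ u = opC δ 0 + u ^ 2 • 1 := by
  rw [opC, opC, zero_pow two_ne_zero, zero_smul, add_zero]

theorem opC_neg : opC δ (-u) = opC δ u := by
  rw [opC, opC, neg_sq]

theorem opU_zero_zero : opU δ u 0 0 = opA δ u := rfl

theorem opU_zero_one : opU δ u 0 1 = opB := rfl

theorem opU_one_zero : opU δ u 1 0 = opC δ u := rfl

theorem opU_one_one : opU δ u 1 1 = opDD δ u := rfl

theorem opU_eq_shiftMatrix :
    opU δ u = shiftMatrix opXinv opD (opC δ 0) u (δ / (u - 1 / 2)) := by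
  rw [opU, opA_eq, opDD_eq, opC_eq]
  rfl

variable {δ u}

theorem div_mul_of_mem_spectralSet (hu : u ∈ spectralSet δ) :
    δ / (u - 1 / 2) * (u - 1 / 2) = δ := by
  rcases hu with rfl | h
  · rw [zero_div, zero_mul]
  · exact div_mul_cancel₀ _ (sub_ne_zero.2 h)

theorem opA_neg_and_opDD_neg (hu : u ∈ spectralSet δ) (hu' : -u ∈ spectralSet δ)
    (h : 2 * u + 1 ≠ 0) :
    -opA δ (-u) = opDD δ u - (2 * u + 1)⁻¹ • (opA δ u + opDD δ u) ∧
      -opDD δ (-u) = opA δ u - (2 * u + 1)⁻¹ • (opA δ u + opDD δ u) := by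
  have hκ := div_mul_of_mem_spectralSet hu
  have hη := div_mul_of_mem_spectralSet hu'
  have hinv : (2 * u + 1)⁻¹ * (2 * u + 1) = 1 := inv_mul_cancel₀ h
  simp only [opA_eq, opDD_eq]
  generalize δ / (u - 1 / 2) = κ at *
  generalize δ / (-u - 1 / 2) = η at *
  generalize (2 * u + 1)⁻¹ = c at *
  have hη_eq : η = -κ * (2 * u - 1) * c := by
    linear_combination (-2 * c) * hη + (2 * c) * hκ - η * hinv
  subst hη_eq
  constructor <;> match_scalars <;> grind

theorem isQISMRep_opU (δ : ℂ) : IsQISMRep (spectralSet δ) (opU δ) := by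
  refine isQISMRep_of_relations (fun u hu v hv => ?_) (fun u hu hu' h => ?_)
    (fun u hu hu' h => ?_) (fun u _ _ => ?_) (fun u _ _ => ?_)
  · rw [opU_eq_shiftMatrix, opU_eq_shiftMatrix]
    exact (isShiftTriple_op δ).reflectionLeft_eq_reflectionRight (div_mul_of_mem_spectralSet hu)
      (div_mul_of_mem_spectralSet hv)
  · rw [opU_zero_zero, opU_zero_zero, opU_one_one, (opA_neg_and_opDD_neg hu hu' h).1]
  · rw [opU_one_one, opU_one_one, opU_zero_zero, (opA_neg_and_opDD_neg hu hu' h).2]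
  · rw [opU_zero_one, opU_zero_one]
  · rw [opU_one_zero, opU_one_zero, opC_neg]

end Operators

section NullSpace

open Set Filter Asymptotics

/-! ### The null space of `C(u)` -/

theorem hasDerivAt_eval_inv (P : Polynomial ℂ) {x : ℝ} (hx : 0 < x) :
    HasDerivAt (fun x : ℝ => P.eval (x : ℂ)⁻¹)
      (-((x : ℂ)⁻¹ ^ 2 * P.derivative.eval (x : ℂ)⁻¹)) x := by
  have hx' : (x : ℂ) ≠ 0 := Complex.ofReal_ne_zero.2 hx.ne'
  refine ((P.hasDerivAt _).comp x ((hasDerivAt_ofReal x).fun_inv hx')).congr_deriv ?_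
  field_simp

theorem hasPolyGrowth_eval_inv (P : Polynomial ℂ) :
    HasPolyGrowth fun x : ℝ => P.eval (x : ℂ)⁻¹ := by
  induction P using Polynomial.induction_on' with
  | add p q hp hq => simpa only [Polynomial.eval_add] using hp.add hq
  | monomial n k =>
    simp only [Polynomial.eval_monomial]
    refine (hasPolyGrowth_const k).mul ?_
    induction n with
    | zero => simpa only [pow_zero] using hasPolyGrowth_const 1
    | succ n ih => simpa only [pow_succ] using ih.mul hasPolyGrowth_inv

/-- The function `x ^ u * exp (-x / 2) * f x` on `(0, ∞)`, extended by zero to `ℝ`. If `f` is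
Tricomi's function with `c = 2 * u + 1`, then it is `x ^ (-1 / 2)` times a Whittaker function. -/
noncomputable def whittaker (u : ℂ) (f : ℝ → ℂ) : ℝ → ℂ :=
  (Ioi 0).indicator fun x => cpowExp u (1 / 2) x * f x

section Whittaker

variable {u : ℂ} {f g : ℝ → ℂ}

theorem whittaker_apply {x : ℝ} (hx : 0 < x) : whittaker u f x = cpowExp u (1 / 2) x * f x :=
  indicator_of_mem (mem_Ioi.2 hx) _

theorem whittaker_congr (h : EqOn f g (Ioi 0)) : whittaker u f = whittaker u g :=
  indicator_congr fun x hx => by rw [h hx]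

theorem whittaker_eventuallyEq (u : ℂ) (f : ℝ → ℂ) {x : ℝ} (hx : 0 < x) :
    whittaker u f =ᶠ[𝓝 x] fun y => cpowExp u (1 / 2) y * f y :=
  (eqOn_indicator (s := Ioi 0)).eventuallyEq_of_mem (Ioi_mem_nhds hx)

theorem hasDerivAt_cpowExp_mul (u b : ℂ) {f' : ℂ} {x : ℝ} (hx : 0 < x) (hf : HasDerivAt f f' x) :
    HasDerivAt (fun y => cpowExp u b y * f y)
      (cpowExp u b x * ((u * (x : ℂ)⁻¹ - b) * f x + f')) x :=
  ((hasDerivAt_cpowExp u b hx).mul hf).congr_deriv (by ring)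

theorem deriv_whittaker (hf : AnalyticOnNhd ℝ f (Ioi 0)) {x : ℝ} (hx : 0 < x) :
    deriv (whittaker u f) x = cpowExp u (1 / 2) x * ((u * (x : ℂ)⁻¹ - 1 / 2) * f x + deriv f x) :=
  (whittaker_eventuallyEq u f hx).deriv_eq.trans
    (hasDerivAt_cpowExp_mul u _ hx (hf x hx).differentiableAt.hasDerivAt).deriv

theorem deriv_deriv_whittaker (hf : AnalyticOnNhd ℝ f (Ioi 0)) {x : ℝ} (hx : 0 < x) :
    deriv (deriv (whittaker u f)) x = cpowExp u (1 / 2) x *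
      (((u * (x : ℂ)⁻¹ - 1 / 2) ^ 2 - u * (x : ℂ)⁻¹ ^ 2) * f x +
        2 * (u * (x : ℂ)⁻¹ - 1 / 2) * deriv f x + deriv (deriv f) x) := by
  have hinv : HasDerivAt (fun y : ℝ => u * (y : ℂ)⁻¹ - 1 / 2) (u * -(x : ℂ)⁻¹ ^ 2) x :=
    (((hasDerivAt_ofReal x).fun_inv (Complex.ofReal_ne_zero.2 hx.ne')).const_mul u).sub_const
      (1 / 2) |>.congr_deriv (by ring)
  have heq : deriv (whittaker u f) =ᶠ[𝓝 x] fun y =>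
      cpowExp u (1 / 2) y * ((u * (y : ℂ)⁻¹ - 1 / 2) * f y + deriv f y) := by
    filter_upwards [Ioi_mem_nhds hx] with y hy using deriv_whittaker hf hy
  rw [heq.deriv_eq, (hasDerivAt_cpowExp_mul u _ hx ((hinv.fun_mul
    (hf x hx).differentiableAt.hasDerivAt).fun_add
      (hf.deriv x hx).differentiableAt.hasDerivAt)).deriv]
  ring

variable {A B : Polynomial ℂ} (hf : AnalyticOnNhd ℝ f (Ioi 0))
  (hode : ∀ x : ℝ, 0 < x →
    deriv (deriv f) x = A.eval (x : ℂ)⁻¹ * f x + B.eval (x : ℂ)⁻¹ * deriv f x)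

include hf hode

theorem exists_iteratedDeriv_whittaker_eq (u : ℂ) (p : ℕ) :
    ∃ P Q : Polynomial ℂ, ∀ x : ℝ, 0 < x → iteratedDeriv p (whittaker u f) x =
      cpowExp u (1 / 2) x * (P.eval (x : ℂ)⁻¹ * f x + Q.eval (x : ℂ)⁻¹ * deriv f x) := by
  induction p with
  | zero => exact ⟨1, 0, fun x hx => by simp [whittaker_apply hx]⟩
  | succ p ih =>
    obtain ⟨P, Q, h⟩ := ih
    let E : Polynomial ℂ := Polynomial.C u * Polynomial.X - Polynomial.C (1 / 2)
    refine ⟨E * P - Polynomial.X ^ 2 * P.derivative + Q * A,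
      E * Q - Polynomial.X ^ 2 * Q.derivative + P + Q * B, fun x hx => ?_⟩
    have heq : iteratedDeriv p (whittaker u f) =ᶠ[𝓝 x] fun x =>
        cpowExp u (1 / 2) x * (P.eval (x : ℂ)⁻¹ * f x + Q.eval (x : ℂ)⁻¹ * deriv f x) := by
      filter_upwards [Ioi_mem_nhds hx] with y hy using h y hy
    rw [iteratedDeriv_succ, heq.deriv_eq, (hasDerivAt_cpowExp_mul u _ hx
      (((hasDerivAt_eval_inv P hx).fun_mul (hf x hx).differentiableAt.hasDerivAt).fun_add
        ((hasDerivAt_eval_inv Q hx).fun_mul (hf.deriv x hx).differentiableAt.hasDerivAt))).deriv,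
      hode x hx]
    simp only [E, Polynomial.eval_add, Polynomial.eval_sub, Polynomial.eval_mul,
      Polynomial.eval_pow, Polynomial.eval_X, Polynomial.eval_C]
    ring

theorem isRapid_whittaker_of_ode (u : ℂ) (pf : HasPolyGrowth f) (pf' : HasPolyGrowth (deriv f)) :
    IsRapid (whittaker u f) where
  zero x hx := indicator_of_notMem (notMem_Ioi.2 hx) _
  analytic x hx := ((analyticOnNhd_cpowExp u _ x hx).mul (hf x hx)).congr
    (whittaker_eventuallyEq u f hx).symm
  decay p N := by
    obtain ⟨P, Q, h⟩ := exists_iteratedDeriv_whittaker_eq hf hode u p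
    refine (tendsto_cpowExp_mul (N + u) (b := 1 / 2) (by norm_num)
      (((hasPolyGrowth_eval_inv P).mul pf).add ((hasPolyGrowth_eval_inv Q).mul pf'))).congr' ?_
    filter_upwards [eventually_gt_atTop 0] with x hx
    rw [h x hx, cpowExp, cpowExp, Complex.cpow_add _ _ (Complex.ofReal_ne_zero.2 hx.ne'),
      Complex.cpow_natCast]
    ring

end Whittaker

namespace IsTricomiPsi

variable {a c u : ℂ} {f : ℝ → ℂ}

theorem isRapid_whittaker (u : ℂ) (h : IsTricomiPsi a c f) : IsRapid (whittaker u f) :=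
  isRapid_whittaker_of_ode (A := Polynomial.C a * Polynomial.X)
    (B := 1 - Polynomial.C c * Polynomial.X) h.analytic
    (fun x hx => by rw [h.deriv_deriv_eq hx]; simp; ring) u h.growth
    (.of_isBigO_cpow h.deriv_isBigO)

theorem deriv_deriv_whittaker_eq (h : IsTricomiPsi a (2 * u + 1) f) {x : ℝ} (hx : 0 < x) :
    deriv (deriv (whittaker u f)) x = -(x : ℂ)⁻¹ * deriv (whittaker u f) x +
      (1 / 4 + (a - u - 1 / 2) * (x : ℂ)⁻¹ + u ^ 2 * (x : ℂ)⁻¹ ^ 2) * whittaker u f x := by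
  rw [deriv_deriv_whittaker h.analytic hx, deriv_whittaker h.analytic hx, whittaker_apply hx,
    h.deriv_deriv_eq hx]
  ring

end IsTricomiPsi

variable {δ u : ℂ}

theorem opC_apply (f : rapidSpace) (x : ℝ) : (opC δ u f).1 x =
    -(x * (x * deriv (deriv f.1) x)) - x * deriv f.1 x + 1 / 4 * (x * (x * f.1 x)) +
      2 * δ * (x * f.1 x) + u ^ 2 * f.1 x := rfl

theorem opC_apply_eq_zero_iff {f : rapidSpace} : opC δ u f = 0 ↔ ∀ x : ℝ, 0 < x →
    deriv (deriv f.1) x = -(x : ℂ)⁻¹ * deriv f.1 x +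
      (1 / 4 + 2 * δ * (x : ℂ)⁻¹ + u ^ 2 * (x : ℂ)⁻¹ ^ 2) * f.1 x := by
  refine ⟨fun h x hx => ?_, fun h => rapidSpace_ext fun x hx => ?_⟩
  all_goals have hx' : (x : ℂ) ≠ 0 := Complex.ofReal_ne_zero.2 (ne_of_gt hx)
  · have h0 : (opC δ u f).1 x = 0 := by rw [h]; rfl
    rw [opC_apply] at h0
    field_simp
    linear_combination -4 * h0
  · rw [opC_apply, h x hx]
    change _ = (0 : ℂ)
    field_simp
    ring

theorem exists_ne_zero_of_ne_zero {g : rapidSpace} (hg : g ≠ 0) : ∃ x : ℝ, 0 < x ∧ g.1 x ≠ 0 := by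
  by_contra! h
  exact hg (rapidSpace_ext h)

theorem tendsto_cpowExp_mul_wronskian {f g : ℝ → ℂ} (hf : IsRapid f) (hg : IsRapid g) :
    Tendsto (fun x => cpowExp 1 0 x * wronskian f g x) atTop (𝓝 0) := by
  have h := ((hf.decay 1 1).mul (hg.decay 0 0)).sub ((hf.decay 0 0).mul (hg.decay 1 1))
  rw [mul_zero, sub_zero] at h
  refine h.congr fun x => ?_
  simp only [cpowExp, wronskian, iteratedDeriv_one, iteratedDeriv_zero, Complex.cpow_one, zero_mul,
    neg_zero, Complex.exp_zero]
  ring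

theorem exists_eq_smul_of_opC_eq_zero {f g : rapidSpace} (hf : opC δ u f = 0)
    (hg : opC δ u g = 0) (hg0 : g ≠ 0) : ∃ k : ℂ, f = k • g := by
  obtain ⟨x₀, hx₀, h0⟩ := exists_ne_zero_of_ne_zero hg0
  have hfa := IsRapid.analytic f.2
  have hga := IsRapid.analytic g.2
  have hode {f : rapidSpace} (hf : opC δ u f = 0) (x : ℝ) (hx : 0 < x) :
      deriv (deriv f.1) x = -(1 * (x : ℂ)⁻¹ - 0) * deriv f.1 x +
        (1 / 4 + 2 * δ * (x : ℂ)⁻¹ + u ^ 2 * (x : ℂ)⁻¹ ^ 2) * f.1 x := by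
    rw [one_mul, sub_zero, opC_apply_eq_zero_iff.1 hf x hx]
  have hwronskian (x : ℝ) (hx : 0 < x) : wronskian f.1 g.1 x = 0 := by
    have hzero : cpowExp 1 0 x * wronskian f.1 g.1 x = 0 := by
      refine tendsto_nhds_unique (tendsto_const_nhds.congr' ?_)
        (tendsto_cpowExp_mul_wronskian f.2 g.2)
      filter_upwards [eventually_gt_atTop 0] with y hy
      exact cpowExp_mul_wronskian_eq hfa hga (hode hf) (hode hg) hx hy
    exact (mul_eq_zero.1 hzero).resolve_left (cpowExp_ne_zero 1 0 hx)
  obtain ⟨k, hk⟩ := exists_eq_mul_of_wronskian_eq_zero hfa hga hwronskian hx₀ h0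
  exact ⟨k, rapidSpace_ext hk⟩

/-- The element `F(u)` of `W`. -/
noncomputable def tricomiF (δ u : ℂ) : rapidSpace :=
  ⟨whittaker u (tricomiPsi (2 * δ + 1 / 2 + u) (2 * u + 1)),
    (isTricomiPsi_tricomiPsi _ _).isRapid_whittaker u⟩

theorem tricomiF_apply (δ u : ℂ) {x : ℝ} (hx : 0 < x) : (tricomiF δ u).1 x =
    (x : ℂ) ^ u * Complex.exp (-(x : ℂ) / 2) * tricomiPsi (2 * δ + 1 / 2 + u) (2 * u + 1) x := by
  refine (whittaker_apply hx).trans ?_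
  rw [cpowExp, one_div_mul_eq_div, neg_div]

theorem opC_tricomiF (δ u : ℂ) : opC δ u (tricomiF δ u) = 0 :=
  opC_apply_eq_zero_iff.2 fun x hx =>
    ((isTricomiPsi_tricomiPsi _ _).deriv_deriv_whittaker_eq hx).trans (by rw [tricomiF]; ring)

theorem tricomiF_ne_zero (δ u : ℂ) : tricomiF δ u ≠ 0 := by
  obtain ⟨x, hx, hne⟩ := (isTricomiPsi_tricomiPsi (2 * δ + 1 / 2 + u) (2 * u + 1)).exists_ne_zero
  intro h
  have h0 : (tricomiF δ u).1 x = 0 := by rw [h]; rfl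
  exact mul_ne_zero (cpowExp_ne_zero u _ hx) hne ((whittaker_apply hx).symm.trans h0)

theorem finrank_ker_opC (δ u : ℂ) : Module.finrank ℂ (LinearMap.ker (opC δ u)) = 1 := by
  let F : LinearMap.ker (opC δ u) := ⟨tricomiF δ u, LinearMap.mem_ker.2 (opC_tricomiF δ u)⟩
  have hF : F ≠ 0 := fun h => tricomiF_ne_zero δ u (congrArg Subtype.val h)
  refine (finrank_eq_one_iff_of_nonzero' F hF).2 fun f => ?_
  obtain ⟨k, hk⟩ := exists_eq_smul_of_opC_eq_zero (LinearMap.mem_ker.1 f.2) (opC_tricomiF δ u)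
    (tricomiF_ne_zero δ u)
  exact ⟨k, Subtype.ext hk.symm⟩

end NullSpace

section LowerEnd

open Set Filter Asymptotics

/-! ### The kernel of `A(u)` on the null space of `C(u)` -/

variable {δ u : ℂ}

theorem opA_apply (f : rapidSpace) (x : ℝ) : (opA δ u f).1 x =
    u * ((x : ℂ)⁻¹ * f.1 x) + deriv f.1 x + δ / (u - 1 / 2) * f.1 x := by
  rw [opA_eq]
  rfl

theorem opA_apply_eq_zero_iff_deriv {f : rapidSpace} : opA δ u f = 0 ↔ ∀ x : ℝ, 0 < x →
    deriv f.1 x = -(u * (x : ℂ)⁻¹ + δ / (u - 1 / 2)) * f.1 x := by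
  refine ⟨fun h x _ => ?_, fun h => rapidSpace_ext fun x hx => ?_⟩
  · have h0 : (opA δ u f).1 x = 0 := by rw [h]; rfl
    rw [opA_apply] at h0
    linear_combination h0
  · rw [opA_apply, h x hx]
    change _ = (0 : ℂ)
    ring

theorem sq_eq_of_opA_apply_eq_zero (hu : u ∈ spectralSet δ) {w : rapidSpace} (hw : w ≠ 0)
    (hC : opC δ u w = 0) (hA : opA δ u w = 0) : (δ / (u - 1 / 2)) ^ 2 = (1 / 2) ^ 2 := by
  have hfactor := LinearMap.congr_fun
    ((isShiftTriple_op δ).factorization (div_mul_of_mem_spectralSet hu)) w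
  rw [← opA_eq, ← opC_eq, Module.End.mul_apply, hA, map_zero, LinearMap.add_apply,
    Module.End.mul_apply, Module.End.mul_apply, hC, map_zero, map_zero, zero_add,
    LinearMap.smul_apply, Module.End.one_apply] at hfactor
  linear_combination (smul_eq_zero.1 hfactor.symm).resolve_right hw

theorem hasPolyGrowth_of_isRapid {f : ℝ → ℂ} (hf : IsRapid f) : HasPolyGrowth f :=
  ⟨0, by simpa using (hf.decay 0 0).isBigO_one ℝ⟩

theorem eq_zero_of_deriv_eq {b : ℂ} (hb : 0 < b.re) {w : rapidSpace}
    (h : ∀ x : ℝ, 0 < x → deriv w.1 x = -(u * (x : ℂ)⁻¹ - b) * w.1 x) : w = 0 := by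
  have hderiv (x : ℝ) (hx : 0 < x) : HasDerivAt (fun y => cpowExp u b y * w.1 y) 0 x :=
    (hasDerivAt_cpowExp_mul u b hx (IsRapid.analytic w.2 x hx).differentiableAt.hasDerivAt)
      |>.congr_deriv (by rw [h x hx]; ring)
  refine rapidSpace_ext fun x hx => ?_
  have hzero : cpowExp u b x * w.1 x = 0 := by
    refine tendsto_nhds_unique (tendsto_const_nhds.congr' ?_)
      (tendsto_cpowExp_mul u hb (hasPolyGrowth_of_isRapid w.2))
    filter_upwards [eventually_gt_atTop 0] with y hy
    exact isOpen_Ioi.is_const_of_deriv_eq_zero isPreconnected_Ioi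
      (fun z hz => (hderiv z hz).differentiableAt.differentiableWithinAt)
      (fun z hz => (hderiv z hz).deriv) hx hy
  exact (mul_eq_zero.1 hzero).resolve_left (cpowExp_ne_zero u b hx)

theorem isTricomiPsi_zero_one (c : ℂ) : IsTricomiPsi 0 c fun _ => 1 :=
  isTricomiPsi_of_hasDerivAt (f' := 0) (f'' := 0) analyticOnNhd_const
    (fun x _ => hasDerivAt_const x 1) (fun x _ => hasDerivAt_const x 0) (by simp)
    (by simpa using isBigO_zero _ _)

theorem opA_tricomiF_neg (hu : u ≠ 1 / 2) (h : u = 2 * δ + 1 / 2) :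
    opA δ u (tricomiF δ (-u)) = 0 := by
  have hκ : δ / (u - 1 / 2) = 1 / 2 := by
    rw [div_eq_iff (sub_ne_zero.2 hu), h]
    ring
  have ha : 2 * δ + 1 / 2 + -u = 0 := by rw [h]; ring
  have hψ : EqOn (tricomiPsi (2 * δ + 1 / 2 + -u) (2 * -u + 1)) (fun _ => 1) (Ioi 0) := by
    rw [ha]
    exact (isTricomiPsi_tricomiPsi _ _).eqOn (isTricomiPsi_zero_one _)
  have hF : (tricomiF δ (-u)).1 = whittaker (-u) fun _ => 1 := whittaker_congr hψ
  refine opA_apply_eq_zero_iff_deriv.2 fun x hx => ?_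
  rw [hF, deriv_whittaker analyticOnNhd_const hx, whittaker_apply hx, hκ, deriv_const]
  ring

theorem opA_apply_eq_zero_iff (hu : u ≠ 1 / 2) {w : rapidSpace} (hw : w ≠ 0)
    (hC : opC δ u w = 0) : opA δ u w = 0 ↔ u = 2 * δ + 1 / 2 := by
  constructor
  · intro hA
    rcases sq_eq_sq_iff_eq_or_eq_neg.1 (sq_eq_of_opA_apply_eq_zero (.inr hu) hw hC hA) with h | h
    · rw [div_eq_iff (sub_ne_zero.2 hu)] at h
      linear_combination -2 * h
    · refine absurd (eq_zero_of_deriv_eq (u := u) (b := 1 / 2) (by norm_num) fun x hx => ?_) hw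
      rw [opA_apply_eq_zero_iff_deriv.1 hA x hx, h]
      ring
  · intro h
    obtain ⟨k, rfl⟩ := exists_eq_smul_of_opC_eq_zero hC
      ((opC_neg δ u).symm ▸ opC_tricomiF δ (-u)) (tricomiF_ne_zero δ (-u))
    rw [map_smul, opA_tricomiF_neg hu h, smul_zero]

end LowerEnd

section Laguerre

open Set Filter Asymptotics Polynomial

/-! ### Laguerre polynomials -/

theorem isBigO_eval_of_degree_lt {P : ℂ[X]} {n : ℕ} (h : P.degree < n) :
    (fun x : ℝ => P.eval (x : ℂ)) =O[atTop] fun x : ℝ => (x : ℂ) ^ ((n : ℂ) - 1) := by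
  simp only [eval_eq_sum, Polynomial.sum]
  refine IsBigO.fun_sum fun i hi => IsBigO.const_mul_left ?_ _
  have hin : i + 1 ≤ n := Nat.cast_lt.1 ((le_degree_of_mem_supp i hi).trans_lt h)
  have hin' : (i : ℝ) ≤ n - 1 := le_sub_iff_add_le.2 (by exact_mod_cast hin)
  simpa only [Complex.cpow_natCast] using
    isBigO_cpow_of_re_le (a := i) (b := n - 1) (by simpa using hin')

theorem hasDerivAt_eval_ofReal (P : ℂ[X]) (x : ℝ) :
    HasDerivAt (fun x : ℝ => P.eval (x : ℂ)) (P.derivative.eval (x : ℂ)) x :=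
  (P.hasDerivAt (x : ℂ)).comp_ofReal

theorem isTricomiPsi_eval_of_monic {P : ℂ[X]} (hP : P.Monic) {c : ℂ}
    (hode : X * derivative (derivative P) + (C c - X) * derivative P +
      C (P.natDegree : ℂ) * P = 0) :
    IsTricomiPsi (-P.natDegree) c fun x => P.eval (x : ℂ) := by
  refine isTricomiPsi_of_hasDerivAt
    (fun x _ => (analyticOnNhd_ofReal univ x trivial).aeval_polynomial P)
    (fun x _ => hasDerivAt_eval_ofReal P x) (fun x _ => hasDerivAt_eval_ofReal _ x)
    (fun x _ => ?_) ?_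
  · have h := congrArg (eval (x : ℂ)) hode
    simp only [eval_add, eval_mul, eval_X, eval_sub, eval_C, eval_zero] at h
    rwa [neg_mul, sub_neg_eq_add]
  · have hdeg : (P - X ^ P.natDegree).degree < (P.natDegree : WithBot ℕ) := by
      rw [← degree_eq_natDegree hP.ne_zero]
      refine degree_sub_lt_left ?_ hP.ne_zero ?_
      · rw [degree_X_pow, degree_eq_natDegree hP.ne_zero]
      · rw [hP.leadingCoeff, leadingCoeff_X_pow]
    simpa only [neg_neg, Complex.cpow_natCast, eval_sub, eval_pow, eval_X] using
      isBigO_eval_of_degree_lt hdeg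

theorem laguerrePoly_coeff (n : ℕ) (α : ℂ) (k : ℕ) : (laguerrePoly n α).coeff k =
    if k ≤ n then (-1) ^ k * (ascPochhammer ℂ (n - k)).eval (α + k + 1) /
      ((n - k).factorial * k.factorial : ℂ) else 0 := by
  simp only [laguerrePoly, finsetSum_coeff, coeff_monomial, Finset.sum_ite_eq', Finset.mem_range,
    Nat.lt_succ_iff]

theorem laguerrePoly_coeff_self (n : ℕ) (α : ℂ) :
    (laguerrePoly n α).coeff n = (-1) ^ n / n.factorial := by
  simp [laguerrePoly_coeff]

theorem laguerrePoly_natDegree (n : ℕ) (α : ℂ) : (laguerrePoly n α).natDegree = n := by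
  refine natDegree_eq_of_le_of_coeff_ne_zero (natDegree_le_iff_coeff_eq_zero.2 fun k hk => ?_) ?_
  · rw [laguerrePoly_coeff, if_neg (by omega)]
  · simp [laguerrePoly_coeff_self, Nat.factorial_ne_zero]

theorem laguerrePoly_coeff_succ (n : ℕ) (α : ℂ) (k : ℕ) :
    (k + 1 : ℂ) * (k + α + 1) * (laguerrePoly n α).coeff (k + 1) =
      (k - n : ℂ) * (laguerrePoly n α).coeff k := by
  rw [laguerrePoly_coeff, laguerrePoly_coeff]
  rcases lt_trichotomy k n with hk | rfl | hk
  · obtain ⟨m, rfl⟩ : ∃ m, n = k + 1 + m := ⟨n - (k + 1), by omega⟩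
    have hm : k + 1 + m - k = m + 1 := by omega
    rw [if_pos (by omega), if_pos hk.le, add_tsub_cancel_left, hm, ascPochhammer_succ_left,
      Nat.factorial_succ, Nat.factorial_succ]
    simp only [eval_mul, eval_X, eval_comp, eval_add, eval_one]
    have hk1 : (k + 1 : ℂ) ≠ 0 := k.cast_add_one_ne_zero
    have hm1 : (m + 1 : ℂ) ≠ 0 := m.cast_add_one_ne_zero
    have hkf : (k.factorial : ℂ) ≠ 0 := Nat.cast_ne_zero.2 k.factorial_ne_zero
    have hmf : (m.factorial : ℂ) ≠ 0 := Nat.cast_ne_zero.2 m.factorial_ne_zero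
    push_cast
    rw [show α + (k + 1) + 1 = α + k + 1 + 1 by ring]
    field_simp
    ring
  · rw [if_neg (by omega), mul_zero, sub_self, zero_mul]
  · rw [if_neg (by omega), if_neg (by omega), mul_zero, mul_zero]

theorem laguerrePoly_ode (n : ℕ) (α : ℂ) :
    X * derivative (derivative (laguerrePoly n α)) +
      (C (α + 1) - X) * derivative (laguerrePoly n α) + C (n : ℂ) * laguerrePoly n α = 0 := by
  ext k
  have hrec := laguerrePoly_coeff_succ n α k
  cases k with
  | zero =>
    simp only [sub_mul, coeff_add, coeff_sub, coeff_C_mul, coeff_X_mul_zero, coeff_derivative,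
      coeff_zero]
    push_cast at hrec ⊢
    linear_combination hrec
  | succ k =>
    simp only [sub_mul, coeff_add, coeff_sub, coeff_C_mul, coeff_X_mul, coeff_derivative,
      coeff_zero]
    push_cast at hrec ⊢
    linear_combination hrec

theorem isTricomiPsi_laguerrePoly (n : ℕ) (α : ℂ) : IsTricomiPsi (-n) (α + 1)
    fun x => (-1) ^ n * n.factorial * (laguerrePoly n α).eval (x : ℂ) := by
  have hlead : (-1) ^ n * (n.factorial : ℂ) * (laguerrePoly n α).leadingCoeff = 1 := by
    have hn : (n.factorial : ℂ) ≠ 0 := Nat.cast_ne_zero.2 n.factorial_ne_zero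
    rw [leadingCoeff, laguerrePoly_natDegree, laguerrePoly_coeff_self]
    field_simp
    rw [← pow_mul, mul_comm, pow_mul, neg_one_sq, one_pow]
  have hdeg : (C ((-1) ^ n * (n.factorial : ℂ)) * laguerrePoly n α).natDegree = n := by
    rw [natDegree_C_mul_of_mul_ne_zero (hlead.trans_ne one_ne_zero), laguerrePoly_natDegree]
  have h := isTricomiPsi_eval_of_monic (monic_C_mul_of_mul_leadingCoeff_eq_one hlead)
    (c := α + 1) <| by
      rw [hdeg, derivative_C_mul, derivative_C_mul]
      linear_combination C ((-1) ^ n * (n.factorial : ℂ)) * laguerrePoly_ode n α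
  simpa only [hdeg, eval_mul, eval_C] using h

theorem pow_natDegree_mul_eval_inv_reverse {K : Type*} [Field K] (P : K[X]) {x : K} (hx : x ≠ 0) :
    x ^ P.natDegree * P.reverse.eval x⁻¹ = P.eval x := by
  let _ := invertibleOfNonzero hx
  have h := eval₂_reverse_mul_pow (RingHom.id K) x P
  rwa [eval₂_id, eval₂_id, invOf_eq_inv, mul_comm] at h

theorem isLaguerreForm_tricomiF {δ u : ℂ} {n : ℕ} (hu : u = -2 * δ - 1 / 2 - n) :
    IsLaguerreForm δ u (tricomiF δ u) := by
  refine ⟨n, hu, fun x hx => ?_⟩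
  have hx' : (x : ℂ) ≠ 0 := Complex.ofReal_ne_zero.2 hx.ne'
  have ha : 2 * δ + 1 / 2 + u = -n := by rw [hu]; ring
  have hψ : tricomiPsi (2 * δ + 1 / 2 + u) (2 * u + 1) x =
      (-1) ^ n * n.factorial * (laguerrePoly n (2 * u)).eval (x : ℂ) := by
    rw [ha]
    exact (isTricomiPsi_tricomiPsi _ _).eqOn (isTricomiPsi_laguerrePoly n (2 * u)) hx
  have hpow : (x : ℂ) ^ (-2 * δ - 1 / 2) = (x : ℂ) ^ u * (x : ℂ) ^ n := by
    rw [← Complex.cpow_natCast, ← Complex.cpow_add _ _ hx', hu, sub_add_cancel]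
  have hrev := pow_natDegree_mul_eval_inv_reverse (laguerrePoly n (2 * u)) hx'
  rw [laguerrePoly_natDegree] at hrev
  rw [tricomiF_apply δ u hx, hψ, hpow, ← hrev]
  constructor <;> ring

end Laguerre

section Ladders

/-! ### The three ladders -/

variable {δ u u₀ : ℂ} {jm : WithBot ℤ} {jp : WithTop ℤ}

theorem meetsShiftHypotheses_tricomiF (hne : ∀ u ∈ ladder u₀ jm jp, u ≠ 1 / 2 ∧ -u ≠ 1 / 2)
    (hlower : ∀ u ∈ ladder u₀ jm jp,
      u = 2 * δ + 1 / 2 ↔ ∃ j : ℤ, jm = (j : WithBot ℤ) ∧ u = u₀ + j + 1)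
    (hupper : ∀ u ∈ ladder u₀ jm jp,
      -u = 2 * δ + 1 / 2 ↔ ∃ j : ℤ, jp = (j : WithTop ℤ) ∧ u = u₀ + j - 1) :
    MeetsShiftHypotheses (spectralSet δ) (opU δ) u₀ jm jp (tricomiF δ) where
  isRep := isQISMRep_opU δ
  mem_domain u hu := ⟨.inr (hne u hu).1, .inr (hne u hu).2⟩
  one_dim u _ := finrank_ker_opC δ u
  lowering u hu _ hw hC := (opA_apply_eq_zero_iff (hne u hu).1 hw hC).trans (hlower u hu)
  raising u hu _ hw hC := neg_eq_zero.trans <|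
    (opA_apply_eq_zero_iff (hne u hu).2 hw ((opC_neg δ u).symm ▸ hC)).trans (hupper u hu)
  ne_zero u _ := tricomiF_ne_zero δ u
  annihilated u _ := opC_tricomiF δ u

theorem exists_nat_of_mem_ladder_coe {N : ℤ} (hu : u ∈ ladder u₀ jm (N : WithTop ℤ)) :
    ∃ n : ℕ, u = u₀ + (N - 1) - n := by
  obtain ⟨m, -, hm, rfl⟩ := hu
  obtain ⟨n, hn⟩ := Int.le.dest (Int.le_sub_one_of_lt (WithTop.coe_lt_coe.1 hm))
  have hn' : (m : ℂ) + n = N - 1 := by exact_mod_cast hn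
  exact ⟨n, by linear_combination hn'⟩

theorem intCast_ne_one_half (k : ℤ) : (k : ℂ) ≠ 1 / 2 := by
  intro h
  have h2 : 2 * k = 1 := by
    have : 2 * (k : ℂ) = 1 := by rw [h]; norm_num
    exact_mod_cast this
  omega

theorem meetsShiftHypotheses_bot_top
    (h : ∀ k : ℤ, u₀ ≠ (2 * δ + 1 / 2) + k ∧ u₀ ≠ -(2 * δ + 1 / 2) + k)
    (h' : ∀ k : ℤ, u₀ ≠ 1 / 2 + k) :
    MeetsShiftHypotheses (spectralSet δ) (opU δ) u₀ ⊥ ⊤ (tricomiF δ) := by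
  refine meetsShiftHypotheses_tricomiF ?_ ?_ ?_ <;> rintro _ ⟨m, -, -, rfl⟩
  · refine ⟨fun e => h' (-m) ?_, fun e => h' (-1 - m) ?_⟩ <;> push_cast
    · linear_combination e
    · linear_combination -e
  · refine iff_of_false (fun e => (h (-m)).1 ?_) (by simp)
    push_cast
    linear_combination e
  · refine iff_of_false (fun e => (h (-m)).2 ?_) (by simp)
    push_cast
    linear_combination -e

theorem meetsShiftHypotheses_bot_one (h : ∀ n : ℕ, -4 * δ - 1 ≠ n) (hδ : δ ≠ 0) :
    MeetsShiftHypotheses (spectralSet δ) (opU δ) (-2 * δ - 1 / 2) ⊥ ((1 : ℤ) : WithTop ℤ)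
      (tricomiF δ) := by
  refine meetsShiftHypotheses_tricomiF ?_ ?_ ?_ <;> intro u hu
  all_goals
    obtain ⟨n, rfl⟩ := exists_nat_of_mem_ladder_coe hu
    rw [Int.cast_one, sub_self, add_zero]
  · refine ⟨fun e => h (2 * n + 1) ?_, fun e => ?_⟩
    · push_cast
      linear_combination 2 * e
    · cases n with
      | zero => exact hδ (by push_cast at e; linear_combination e / 2)
      | succ n =>
        refine h (2 * n + 1) ?_
        push_cast at e ⊢
        linear_combination -2 * e
  · exact iff_of_false (fun e => h n (by linear_combination e)) (by simp)
  · rw [neg_eq_iff_eq_neg, show -(2 * δ + 1 / 2) = -2 * δ - 1 / 2 by ring]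
    simp

theorem meetsShiftHypotheses_finite {m : ℕ} (h : 2 * δ + 1 / 2 = -(m : ℂ)) :
    MeetsShiftHypotheses (spectralSet δ) (opU δ) (2 * δ + 1 / 2)
      ((-1 : ℤ) : WithBot ℤ) ((2 * m + 1 : ℤ) : WithTop ℤ) (tricomiF δ) := by
  refine meetsShiftHypotheses_tricomiF ?_ ?_ ?_
  · rintro _ ⟨k, -, -, rfl⟩
    rw [h]
    exact ⟨by simpa using intCast_ne_one_half (-m + k),
      by simpa [neg_add_eq_sub] using intCast_ne_one_half (m - k)⟩
  · intro u _
    simp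
  · intro u _
    have htop : -(m : ℂ) + (2 * m + 1 : ℤ) - 1 = m := by
      push_cast
      ring
    simp only [neg_eq_iff_eq_neg, h, neg_neg, WithTop.coe_inj, exists_eq_left', htop]

end Ladders

theorem mainTheorem10 (δ : ℂ) :
    ∃ F : ℂ → rapidSpace,
      (∀ (u : ℂ) (x : ℝ), 0 < x → (F u).1 x =
        (x : ℂ) ^ u * Complex.exp (-(x : ℂ) / 2) * tricomiPsi (2 * δ + 1 / 2 + u) (2 * u + 1) x) ∧
      (∀ u₀ : ℂ, (∀ k : ℤ, u₀ ≠ (2 * δ + 1 / 2) + k ∧ u₀ ≠ -(2 * δ + 1 / 2) + k) →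
        (∀ k : ℤ, u₀ ≠ 1 / 2 + k) →
        MeetsShiftHypotheses (spectralSet δ) (opU δ) u₀ ⊥ ⊤ F) ∧
      ((∀ n : ℕ, -4 * δ - 1 ≠ n) → δ ≠ 0 →
        MeetsShiftHypotheses (spectralSet δ) (opU δ) (-2 * δ - 1 / 2) ⊥ ((1 : ℤ) : WithTop ℤ) F ∧
        ∀ u ∈ ladder (-2 * δ - 1 / 2) ⊥ ((1 : ℤ) : WithTop ℤ), IsLaguerreForm δ u (F u)) ∧
      (∀ m : ℕ, 2 * δ + 1 / 2 = -(m : ℂ) →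
        MeetsShiftHypotheses (spectralSet δ) (opU δ) (2 * δ + 1 / 2)
          ((-1 : ℤ) : WithBot ℤ) ((2 * m + 1 : ℤ) : WithTop ℤ) F ∧
        ∀ u ∈ ladder (2 * δ + 1 / 2) ((-1 : ℤ) : WithBot ℤ) ((2 * m + 1 : ℤ) : WithTop ℤ),
          IsLaguerreForm δ u (F u)) := by
  refine ⟨tricomiF δ, fun u x => tricomiF_apply δ u, fun u₀ => meetsShiftHypotheses_bot_top,
    fun h hδ => ⟨meetsShiftHypotheses_bot_one h hδ, fun u hu => ?_⟩,
    fun m h => ⟨meetsShiftHypotheses_finite h, fun u hu => ?_⟩⟩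
  all_goals
    obtain ⟨n, hn⟩ := exists_nat_of_mem_ladder_coe hu
    refine isLaguerreForm_tricomiF (n := n) (hn.trans ?_)
    push_cast
  · ring
  · linear_combination 2 * h
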